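/- **Setting.** Let $\mathcal H$ be the set of partial injections of $\mathbb N$, with composition $g\cdot f$ ("first $f$, then $g$"). Let $p,q\in\mathcal H$ be $p(2n)=n$, $q(2n+1)=n$ (undefined elsewhere), let $(\ )^\ddagger$ be the generalised inverse, and identify $f\in\mathcal H$ with its rook matrix $\begin{pmatrix}f_{00}&f_{01}\\f_{10}&f_{11}\end{pmatrix}=\begin{pmatrix}pfp^\ddagger&pfq^\ddagger\\qfp^\ddagger&qfq^\ddagger\end{pmatrix}$, so that $f=p^\ddagger f_{00}p\cup p^\ddagger f_{01}q\cup q^\ddagger f_{10}p\cup q^\ddagger f_{11}q$. Put $f\star g=p^\ddagger fp\cup q^\ddagger gq$. Applying the $\mathbf{Int}$ construction to partial injections with disjoint union (and its particle-style trace), and identifying $\mathbb N\uplus\mathbb N$ with $\mathbb N$ by $(n,i)\mapsto 2n+i$, the endomorphisms of the object $(\mathbb N,\mathbb N)$ of the resulting strictified two-object compact closed category $\mathfrak G$ also form the set $\mathcal H$, with composition $$g\circ f=\begin{pmatrix}\bigcup_{j}g_{00}(f_{01}g_{10})^jf_{00}& g_{01}\cup\bigcup_j g_{00}f_{01}(g_{10}f_{01})^jg_{11}\\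 f_{10}\cup\bigcup_j f_{11}g_{10}(f_{01}g_{10})^jf_{00}&\bigcup_j f_{11}(g_{10}f_{01})^jg_{11}\end{pmatrix}$$ and tensor $$f\,\Box\,g=\begin{pmatrix}p^\ddagger f_{00}p\cup q^\ddagger g_{00}q& p^\ddagger f_{01}q\cup q^\ddagger g_{01}p\\ p^\ddagger g_{10}q\cup q^\ddagger f_{10}p& p^\ddagger g_{11}p\cup q^\ddagger f_{11}q\end{pmatrix}.$$ Both compositions have unit $1=1_{\mathbb N}$. Let $\sigma=p^\ddagger q\cup q^\ddagger p$, $\tau=(p^\ddagger)^2p\cup p^\ddagger q^\ddagger pq\cup q^\ddagger q^2$ and $\tau'=\tau^\ddagger$, and let $T=\tau\star\tau$ and $T'=\tau'\star\tau'$. Then $(\mathcal H,\cdot,\star)$ and $(\mathcal H,\circ,\Box)$ are semi-monoidal monoids (one-object monoidal categories without the unit axioms) with associativity isomorphisms $\tau$ (inverse $\tau'$) and $T$ (inverse $T'$) respectively. $\mathcal F=\langle x_0,x_1,\dots\mid x_i^{-1}x_jx_i=x_{j+1}\ (i<j)\rangle$ is Thompson's group. **Theorem.** 1. The submonoid of $(\mathcal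 H,\cdot)$ generated by $\{\tau,\tau',1\star\tau,1\star\tau'\}$ is a group isomorphic to $\mathcal F$, and it equals the closure of $\{\tau,\tau'\}$ under $\cdot$ and $\star$. 2. The submonoid of $(\mathcal H,\circ)$ generated by $\{T,T',1\Box T,1\Box T'\}$ is a group isomorphic to $\mathcal F$, and it equals the closure of $\{T,T'\}$ under $\circ$ and $\Box$. 3. The elements $\Delta=\tau\cdot(1\star\sigma)$ and $\nabla=(1\star\sigma)\cdot\tau'$ satisfy $\Delta\cdot\nabla=1=\nabla\cdot\Delta$, but $\nabla\circ\Delta=1$ and $\Delta\circ\nabla\neq1$; and $\{\Delta,\nabla\}$ generates in $(\mathcal H,\circ)$ a submonoid isomorphic to the bicyclic monoid $\langle s,r\mid rs=1\rangle$. 4. These elements satisfy * (Frobenius) $(1\Box\nabla)\circ T'\circ(\Delta\Box1)=\Delta\circ\nabla=(\nabla\Box1)\circ T\circ(1\Box\Delta)$, * (associativity) $\nabla\circ(1\Box\nabla)=\nabla\circ(\nabla\Box1)\circ T$, * (co-associativity) $(1\Box\Delta)\circ\Delta=T'\circ(\Delta\Box1)\circ\Delta$, and hence generate the simple Abramsky–Heunen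 Frobenius algebra within $(\mathcal H,\circ,\Box)$: $T,T'$ are the associativity isomorphism of $\mathbf{Int}$ of partial injections at $(\mathbb N,\mathbb N)$ and its inverse, and $\Delta,\nabla$ are the canonical arrows $1_{X^*}\Box\eta_X\Box1_X$ and $1_{X^*}\Box\epsilon\Box1_X$ (where $\epsilon:X\Box X^*\to I$ is the co-unit) at $X^*\Box X\cong(\mathbb N,\mathbb N)$ for $X=(\emptyset,\mathbb N)$, all transported along the identifications above; so the closure of $\{T,T',\Delta,\nabla\}$ under $\circ$ and $\Box$ is the simple Abramsky–Heunen Frobenius monoid. -/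

import Mathlib

namespace GoI

/-! ### Partial injections -/

section PartialInjections

variable {A B C D V : Type}

/-- Partial injections of a set, with `g * f` = "first `f`, then `g`"; the unit is the identity. -/
instance instMonoidPEquiv : Monoid (A ≃. A) where
  mul g f := f.trans g
  one := PEquiv.refl A
  mul_assoc f g h := (PEquiv.trans_assoc h g f).symm
  one_mul f := PEquiv.trans_refl f
  mul_one f := PEquiv.refl_trans f

/-- The partial injection whose graph is a given functional and injective relation. -/
noncomputable def ofRel (R : A → B → Prop)
    (h₁ : ∀ a b b', R a b → R a b' → b = b') (h₂ : ∀ a a' b, R a b → R a' b → a = a') :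
    A ≃. B :=
  open Classical in
  { toFun := fun a => if h : ∃ b, R a b then some h.choose else none
    invFun := fun b => if h : ∃ a, R a b then some h.choose else none
    inv := by
      intro a b
      constructor
      · intro h
        split_ifs at h with h'
        · have hb : R a b := by
            have := h'.choose_spec
            simp only [Option.some.injEq] at h
            rwa [h] at this
          have he : ∃ b, R a b := ⟨b, hb⟩
          simp only [he, dif_pos, Option.some.injEq]
          exact h₁ _ _ _ he.choose_spec hb
      · intro h
        split_ifs at h with h'
        · have hb : R a b := by
            have := h'.choose_spec
            simp only [Option.some.injEq] at h
            rwa [h] at this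
          have he : ∃ a, R a b := ⟨a, hb⟩
          simp only [he, dif_pos, Option.some.injEq]
          exact h₂ _ _ _ he.choose_spec hb }

theorem mem_ofRel {R : A → B → Prop} {h₁ h₂} {a : A} {b : B} :
    b ∈ ofRel R h₁ h₂ a ↔ R a b := by
  classical
  change b ∈ (if h : ∃ b, R a b then some h.choose else none) ↔ _
  constructor
  · intro h
    split_ifs at h with h'
    · have := h'.choose_spec
      simp only [Option.mem_def, Option.some.injEq] at h
      rwa [h] at this
    · simp at h
  · intro hb
    have he : ∃ b, R a b := ⟨b, hb⟩
    simp only [he, dif_pos, Option.mem_def, Option.some.injEq]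
    exact h₁ _ _ _ he.choose_spec hb

/-- The injections into a disjoint union; their generalised inverses `symm` are the projections. -/
def inl : A ≃. A ⊕ B where
  toFun a := some (Sum.inl a)
  invFun := Sum.elim some (fun _ => none)
  inv := by rintro a (b | b) <;> simp [eq_comm]

def inr : B ≃. A ⊕ B where
  toFun b := some (Sum.inr b)
  invFun := Sum.elim (fun _ => none) some
  inv := by rintro a (b | b) <;> simp [eq_comm]

/-- The disjoint union of partial injections. -/
def sum (f : A ≃. B) (g : C ≃. D) : A ⊕ C ≃. B ⊕ D where
  toFun := Sum.elim (fun a => (f a).map Sum.inl) (fun c => (g c).map Sum.inr)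
  invFun := Sum.elim (fun b => (f.symm b).map Sum.inl) (fun d => (g.symm d).map Sum.inr)
  inv := by
    rintro (a | c) (b | d) <;> simp [PEquiv.eq_some_iff]

/-- The graph of the trace `h₀₀ ∪ ⋃ⱼ h₀₁ h₁₁ʲ h₁₀`, where `hᵢⱼ = πᵢ h ιⱼ`. -/
def TraceRel (h : A ⊕ V ≃. B ⊕ V) (a : A) (b : B) : Prop :=
  b ∈ ((inl.trans h).trans inl.symm) a ∨
  ∃ j : ℕ, b ∈
    ((((inl.trans h).trans inr.symm).trans (((inr.trans h).trans inr.symm : V ≃. V) ^ j)).trans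
      ((inr.trans h).trans inl.symm)) a

/-- A run of the feedback loop of `h`, from an input of `h` to an exit in `B`. -/
inductive Exit (h : A ⊕ V ≃. B ⊕ V) : A ⊕ V → B → Prop
  | out {s b} : Sum.inl b ∈ h s → Exit h s b
  | loop {s v b} : Sum.inr v ∈ h s → Exit h (Sum.inr v) b → Exit h s b

theorem inl_symm_mem {s : A ⊕ B} {a : A} : a ∈ (inl : A ≃. A ⊕ B).symm s ↔ s = Sum.inl a := by
  rw [PEquiv.mem_iff_mem]; simp [inl, eq_comm]

theorem inr_symm_mem {s : A ⊕ B} {b : B} : b ∈ (inr : B ≃. A ⊕ B).symm s ↔ s = Sum.inr b := by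
  rw [PEquiv.mem_iff_mem]; simp [inr, eq_comm]

theorem mem_inl {s : A ⊕ B} {a : A} : s ∈ (inl : A ≃. A ⊕ B) a ↔ s = Sum.inl a := by
  simp [inl, eq_comm]

theorem mem_inr {s : A ⊕ B} {b : B} : s ∈ (inr : B ≃. A ⊕ B) b ↔ s = Sum.inr b := by
  simp [inr, eq_comm]

theorem entry_ll (h : A ⊕ V ≃. B ⊕ D) (a b) :
    b ∈ ((inl.trans h).trans inl.symm) a ↔ Sum.inl b ∈ h (Sum.inl a) := by
  simp only [PEquiv.mem_trans, inl_symm_mem, mem_inl]; simp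

theorem entry_lr (h : A ⊕ V ≃. B ⊕ D) (a b) :
    b ∈ ((inl.trans h).trans inr.symm) a ↔ Sum.inr b ∈ h (Sum.inl a) := by
  simp only [PEquiv.mem_trans, inr_symm_mem, mem_inl]; simp

theorem entry_rl (h : A ⊕ V ≃. B ⊕ D) (a b) :
    b ∈ ((inr.trans h).trans inl.symm) a ↔ Sum.inl b ∈ h (Sum.inr a) := by
  simp only [PEquiv.mem_trans, inl_symm_mem, mem_inr]; simp

theorem entry_rr (h : A ⊕ V ≃. B ⊕ D) (a b) :
    b ∈ ((inr.trans h).trans inr.symm) a ↔ Sum.inr b ∈ h (Sum.inr a) := by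
  simp only [PEquiv.mem_trans, inr_symm_mem, mem_inr]; simp

theorem exit_inr_iff (h : A ⊕ V ≃. B ⊕ V) (v : V) (b : B) :
    Exit h (Sum.inr v) b ↔
      ∃ j : ℕ, b ∈ ((((inr.trans h).trans inr.symm : V ≃. V) ^ j).trans
        ((inr.trans h).trans inl.symm)) v := by
  constructor
  · intro H
    generalize hs : (Sum.inr v : A ⊕ V) = s at H
    induction H generalizing v with
    | out h1 =>
      subst hs
      refine ⟨0, ?_⟩
      rw [pow_zero, PEquiv.mem_trans]
      exact ⟨v, rfl, (entry_rl _ _ _).2 h1⟩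
    | loop h1 _ ih =>
      subst hs
      obtain ⟨j, hj⟩ := ih _ rfl
      refine ⟨j + 1, ?_⟩
      rw [pow_succ, PEquiv.mem_trans]
      rw [PEquiv.mem_trans] at hj
      obtain ⟨w, hw, hb⟩ := hj
      exact ⟨w, (PEquiv.mem_trans _ _ _ _).2 ⟨_, (entry_rr _ _ _).2 h1, hw⟩, hb⟩
  · rintro ⟨j, hj⟩
    induction j generalizing v with
    | zero =>
      rw [pow_zero, PEquiv.mem_trans] at hj
      obtain ⟨w, hw, hb⟩ := hj
      obtain rfl : v = w := Option.some.inj hw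
      exact Exit.out ((entry_rl _ _ _).1 hb)
    | succ j ih =>
      rw [pow_succ, PEquiv.mem_trans] at hj
      obtain ⟨w, hw, hb⟩ := hj
      obtain ⟨u, hu, hw'⟩ := (PEquiv.mem_trans _ _ _ _).1 hw
      exact Exit.loop ((entry_rr _ _ _).1 hu)
        (ih u ((PEquiv.mem_trans _ _ _ _).2 ⟨w, hw', hb⟩))

theorem traceRel_iff (h : A ⊕ V ≃. B ⊕ V) (a : A) (b : B) :
    TraceRel h a b ↔ Exit h (Sum.inl a) b := by
  constructor
  · rintro (h0 | ⟨j, hj⟩)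
    · exact Exit.out ((entry_ll _ _ _).1 h0)
    · rw [PEquiv.trans_assoc, PEquiv.mem_trans] at hj
      obtain ⟨v, hv, hb⟩ := hj
      exact Exit.loop ((entry_lr _ _ _).1 hv) ((exit_inr_iff h v b).2 ⟨j, hb⟩)
  · rintro (h1 | ⟨h1, h2⟩)
    · exact Or.inl ((entry_ll _ _ _).2 h1)
    · obtain ⟨j, hj⟩ := (exit_inr_iff h _ b).1 h2
      refine Or.inr ⟨j, ?_⟩
      rw [PEquiv.trans_assoc, PEquiv.mem_trans]
      exact ⟨_, (entry_lr _ _ _).2 h1, hj⟩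

theorem symm_pow (f : V ≃. V) (j : ℕ) : (f ^ j).symm = f.symm ^ j := by
  induction j with
  | zero => rfl
  | succ j ih =>
    rw [pow_succ, pow_succ', ← ih]
    exact PEquiv.symm_trans_rev _ _

theorem traceRel_symm (h : A ⊕ V ≃. B ⊕ V) (a : A) (b : B) :
    TraceRel h.symm b a ↔ TraceRel h a b := by
  have e1 : ((inl.trans h).trans inl.symm).symm = (inl.trans h.symm).trans inl.symm := by
    simp [PEquiv.symm_trans_rev, PEquiv.trans_assoc]
  unfold TraceRel
  refine or_congr ?_ (exists_congr fun j => ?_)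
  · rw [← e1, PEquiv.mem_iff_mem]
  · rw [← PEquiv.mem_iff_mem]
    simp only [PEquiv.symm_trans_rev, symm_pow, PEquiv.symm_symm, PEquiv.trans_assoc]

theorem exit_unique (h : A ⊕ V ≃. B ⊕ V) {s b b'} (H : Exit h s b) (H' : Exit h s b') :
    b = b' := by
  induction H with
  | out h1 =>
    cases H' with
    | out h2 => exact Sum.inl.inj (Option.mem_unique h1 h2)
    | loop h2 _ => exact absurd (Option.mem_unique h1 h2) (by simp)
  | loop h1 _ ih =>
    cases H' with
    | out h2 => exact absurd (Option.mem_unique h1 h2) (by simp)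
    | loop h2 h3 =>
      obtain rfl := Sum.inr.inj (Option.mem_unique h1 h2)
      exact ih h3

theorem traceRel_unique (h : A ⊕ V ≃. B ⊕ V) (a b b') (H : TraceRel h a b)
    (H' : TraceRel h a b') : b = b' :=
  exit_unique h ((traceRel_iff h a b).1 H) ((traceRel_iff h a b').1 H')

/-- The trace `h₀₀ ∪ ⋃ⱼ h₀₁ h₁₁ʲ h₁₀` of a partial injection. -/
noncomputable def trace (h : A ⊕ V ≃. B ⊕ V) : A ≃. B :=
  ofRel (TraceRel h) (traceRel_unique h) fun a a' b H H' =>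
    traceRel_unique h.symm b a a' ((traceRel_symm h a b).2 H) ((traceRel_symm h a' b).2 H')

end PartialInjections

/-! ### The compact closed category `Int(pInj)` -/

/-- Objects of `Int(pInj)` are pairs of sets. -/
structure IntObj where
  pos : Type
  neg : Type

namespace IntObj

/-- `Int(pInj)((X,U),(Y,V)) = pInj(X ⊎ V, Y ⊎ U)`. -/
abbrev Hom (A B : IntObj) : Type := A.pos ⊕ B.neg ≃. B.pos ⊕ A.neg

/-- The symmetry that exchanges the last two summands. -/
def swapRight (X Y Z : Type) : (X ⊕ Y) ⊕ Z ≃ (X ⊕ Z) ⊕ Y :=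
  ((Equiv.sumAssoc X Y Z).trans ((Equiv.refl X).sumCongr (Equiv.sumComm Y Z))).trans
    (Equiv.sumAssoc X Z Y).symm

/-- `X ⊎ W ⊎ V → X ⊎ V ⊎ W → Y ⊎ U ⊎ W → Y ⊎ W ⊎ U → Z ⊎ V ⊎ U → Z ⊎ U ⊎ V`. -/
def preComp {A B C : IntObj} (g : Hom B C) (f : Hom A B) :
    (A.pos ⊕ C.neg) ⊕ B.neg ≃. (C.pos ⊕ A.neg) ⊕ B.neg :=
  ((((swapRight A.pos C.neg B.neg).toPEquiv.trans (sum f (PEquiv.refl C.neg))).trans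
    (swapRight B.pos A.neg C.neg).toPEquiv).trans (sum g (PEquiv.refl A.neg))).trans
      (swapRight C.pos B.neg A.neg).toPEquiv

/-- Composition `g ∘ f` in `Int(pInj)`. -/
noncomputable def comp {A B C : IntObj} (g : Hom B C) (f : Hom A B) : Hom A C :=
  trace (preComp g f)

/-- The identity. -/
def id (A : IntObj) : Hom A A := PEquiv.refl (A.pos ⊕ A.neg)

/-- The arrow given by a bijection of the positive parts and one of the negative parts. -/
def ofEquiv {A B : IntObj} (φ : A.pos ≃ B.pos) (ψ : B.neg ≃ A.neg) : Hom A B :=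
  sum φ.toPEquiv ψ.toPEquiv

/-- The unit object. -/
abbrev unit : IntObj := ⟨Empty, Empty⟩

/-- The dual of an object. -/
abbrev dual (A : IntObj) : IntObj := ⟨A.neg, A.pos⟩

/-- The tensor on objects. -/
abbrev tensor (A B : IntObj) : IntObj := ⟨A.pos ⊕ B.pos, B.neg ⊕ A.neg⟩

/-- `(X ⊎ X') ⊎ (V' ⊎ V) ≃ (X ⊎ V) ⊎ (X' ⊎ V')`. -/
def shuffle (X X' V V' : Type) : (X ⊕ X') ⊕ (V' ⊕ V) ≃ (X ⊕ V) ⊕ (X' ⊕ V') :=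
  ((Equiv.refl (X ⊕ X')).sumCongr (Equiv.sumComm V' V)).trans (Equiv.sumSumSumComm X X' V V')

/-- The tensor on arrows. -/
def tensorHom {A B A' B' : IntObj} (f : Hom A B) (g : Hom A' B') :
    Hom (tensor A A') (tensor B B') :=
  ((shuffle A.pos A'.pos B.neg B'.neg).toPEquiv.trans (sum f g)).trans
    (shuffle B.pos B'.pos A.neg A'.neg).symm.toPEquiv

/-- The associativity isomorphism and its inverse. -/
def assoc (A B C : IntObj) : Hom (tensor A (tensor B C)) (tensor (tensor A B) C) :=
  ofEquiv (A := tensor A (tensor B C)) (B := tensor (tensor A B) C)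
    (Equiv.sumAssoc A.pos B.pos C.pos).symm (Equiv.sumAssoc C.neg B.neg A.neg).symm

def assocInv (A B C : IntObj) : Hom (tensor (tensor A B) C) (tensor A (tensor B C)) :=
  ofEquiv (A := tensor (tensor A B) C) (B := tensor A (tensor B C))
    (Equiv.sumAssoc A.pos B.pos C.pos) (Equiv.sumAssoc C.neg B.neg A.neg)

/-- The left unit isomorphism and its inverse. -/
def leftUnit (A : IntObj) : Hom (tensor unit A) A :=
  ofEquiv (A := tensor unit A) (B := A)
    (Equiv.emptySum Empty A.pos) (Equiv.sumEmpty A.neg Empty).symm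

def leftUnitInv (A : IntObj) : Hom A (tensor unit A) :=
  ofEquiv (A := A) (B := tensor unit A)
    (Equiv.emptySum Empty A.pos).symm (Equiv.sumEmpty A.neg Empty)

/-- The unit `I → A □ A*` of the compact closed structure. -/
def eta (A : IntObj) : Hom unit (tensor A (dual A)) :=
  (Equiv.sumComm Empty (A.pos ⊕ A.neg)).toPEquiv

/-- The co-unit `A □ A* → I` (that is, `ε : U* □ U → I` at `U = A*`). -/
def eps (A : IntObj) : Hom (tensor A (dual A)) unit :=
  (Equiv.sumComm (A.pos ⊕ A.neg) Empty).toPEquiv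

/-- The split arrow `1 □ η □ 1 : A* □ A → (A* □ A) □ (A* □ A)` of the canonical Frobenius
algebra at `A* □ A`, with the canonical isomorphisms made explicit. -/
noncomputable def stdSplit (A : IntObj) :
    Hom (tensor (dual A) A) (tensor (tensor (dual A) A) (tensor (dual A) A)) :=
  comp (assoc (dual A) A (tensor (dual A) A))
    (comp (tensorHom (id (dual A)) (assocInv A (dual A) A))
      (comp (tensorHom (id (dual A)) (tensorHom (eta A) (id A)))
        (tensorHom (id (dual A)) (leftUnitInv A))))

/-- The merge arrow `1 □ ε □ 1 : (A* □ A) □ (A* □ A) → A* □ A`. -/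
noncomputable def stdMerge (A : IntObj) :
    Hom (tensor (tensor (dual A) A) (tensor (dual A) A)) (tensor (dual A) A) :=
  comp (tensorHom (id (dual A)) (leftUnit A))
    (comp (tensorHom (id (dual A)) (tensorHom (eps A) (id A)))
      (comp (tensorHom (id (dual A)) (assoc A (dual A) A))
        (assocInv (dual A) A (tensor (dual A) A))))

/-! Composition in `Int(pInj)` is associative and unital. -/

section Assoc

variable {A B C D : IntObj}

/-- Where a token on the common edge of `g` and `f` may leave `g ∘ f`. -/
inductive Path (g : Hom B C) (f : Hom A B) : B.pos ⊕ B.neg → C.pos ⊕ A.neg → Prop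
  | yOut {y z} : Sum.inl z ∈ g (Sum.inl y) → Path g f (Sum.inl y) (Sum.inl z)
  | yStep {y v o} : Sum.inr v ∈ g (Sum.inl y) → Path g f (Sum.inr v) o →
      Path g f (Sum.inl y) o
  | vOut {v u} : Sum.inr u ∈ f (Sum.inr v) → Path g f (Sum.inr v) (Sum.inr u)
  | vStep {v y o} : Sum.inl y ∈ f (Sum.inr v) → Path g f (Sum.inl y) o →
      Path g f (Sum.inr v) o

/-- The first step into `g ∘ f`, followed by a path. -/
def Enter (g : Hom B C) (f : Hom A B) : A.pos ⊕ C.neg → C.pos ⊕ A.neg → Prop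
  | Sum.inl x, o => (∃ u, Sum.inr u ∈ f (Sum.inl x) ∧ o = Sum.inr u) ∨
      ∃ y, Sum.inl y ∈ f (Sum.inl x) ∧ Path g f (Sum.inl y) o
  | Sum.inr w, o => (∃ z, Sum.inl z ∈ g (Sum.inr w) ∧ o = Sum.inl z) ∨
      ∃ v, Sum.inr v ∈ g (Sum.inr w) ∧ Path g f (Sum.inr v) o

theorem mem_sum_inl {P Q R S : Type} (f : P ≃. Q) (g : R ≃. S) (p : P) (t : Q ⊕ S) :
    t ∈ sum f g (Sum.inl p) ↔ ∃ q, q ∈ f p ∧ t = Sum.inl q := by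
  change t ∈ (f p).map Sum.inl ↔ _
  simp [eq_comm]

theorem mem_sum_inr {P Q R S : Type} (f : P ≃. Q) (g : R ≃. S) (r : R) (t : Q ⊕ S) :
    t ∈ sum f g (Sum.inr r) ↔ ∃ q, q ∈ g r ∧ t = Sum.inr q := by
  change t ∈ (g r).map Sum.inr ↔ _
  simp [eq_comm]

theorem mem_toPEquiv {P Q : Type} (e : P ≃ Q) (p : P) (q : Q) : q ∈ e.toPEquiv p ↔ e p = q := by
  simp

theorem mem_refl {P : Type} (p q : P) : q ∈ PEquiv.refl P p ↔ p = q := by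
  simp

theorem swapRight_ll (X Y Z : Type) (x : X) :
    swapRight X Y Z (Sum.inl (Sum.inl x)) = Sum.inl (Sum.inl x) := rfl
theorem swapRight_lr (X Y Z : Type) (y : Y) :
    swapRight X Y Z (Sum.inl (Sum.inr y)) = Sum.inr y := rfl
theorem swapRight_r (X Y Z : Type) (z : Z) :
    swapRight X Y Z (Sum.inr z) = Sum.inl (Sum.inr z) := rfl

theorem mem_preComp_x (g : Hom B C) (f : Hom A B) (x t) :
    t ∈ preComp g f (Sum.inl (Sum.inl x)) ↔
      (∃ u, Sum.inr u ∈ f (Sum.inl x) ∧ t = Sum.inl (Sum.inr u)) ∨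
      ∃ y, Sum.inl y ∈ f (Sum.inl x) ∧
        ((∃ z, Sum.inl z ∈ g (Sum.inl y) ∧ t = Sum.inl (Sum.inl z)) ∨
          ∃ v, Sum.inr v ∈ g (Sum.inl y) ∧ t = Sum.inr v) := by
  simp only [preComp, PEquiv.mem_trans, mem_toPEquiv, swapRight_ll, mem_sum_inl, exists_eq_left',
    Sum.exists, swapRight_lr, mem_sum_inr, mem_refl, swapRight_r,
    and_or_left, exists_or, @eq_comm _ _ t]
  grind

theorem mem_preComp_v (g : Hom B C) (f : Hom A B) (v t) :
    t ∈ preComp g f (Sum.inr v) ↔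
      (∃ u, Sum.inr u ∈ f (Sum.inr v) ∧ t = Sum.inl (Sum.inr u)) ∨
      ∃ y, Sum.inl y ∈ f (Sum.inr v) ∧
        ((∃ z, Sum.inl z ∈ g (Sum.inl y) ∧ t = Sum.inl (Sum.inl z)) ∨
          ∃ v, Sum.inr v ∈ g (Sum.inl y) ∧ t = Sum.inr v) := by
  simp only [preComp, PEquiv.mem_trans, mem_toPEquiv, swapRight_ll, mem_sum_inl, exists_eq_left',
    Sum.exists, swapRight_lr, mem_sum_inr, mem_refl, swapRight_r,
    and_or_left, exists_or, @eq_comm _ _ t]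
  grind

theorem mem_preComp_w (g : Hom B C) (f : Hom A B) (w t) :
    t ∈ preComp g f (Sum.inl (Sum.inr w)) ↔
      (∃ z, Sum.inl z ∈ g (Sum.inr w) ∧ t = Sum.inl (Sum.inl z)) ∨
          ∃ v, Sum.inr v ∈ g (Sum.inr w) ∧ t = Sum.inr v := by
  simp only [preComp, PEquiv.mem_trans, mem_toPEquiv, swapRight_ll, mem_sum_inl, exists_eq_left',
    Sum.exists, swapRight_lr, mem_sum_inr, mem_refl, swapRight_r,
    and_or_left, exists_or, @eq_comm _ _ t]
  grind

theorem exit_iff_path (g : Hom B C) (f : Hom A B) (v o) :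
    Exit (preComp g f) (Sum.inr v) o ↔ Path g f (Sum.inr v) o := by
  constructor
  · intro H
    generalize hs : (Sum.inr v : (A.pos ⊕ C.neg) ⊕ B.neg) = s at H
    induction H generalizing v with
    | out h1 =>
      subst hs
      rw [mem_preComp_v] at h1
      rcases h1 with ⟨u, hu, e⟩ | ⟨y, hy, ⟨z, hz, e⟩ | ⟨v', hv, e⟩⟩
      · cases e; exact Path.vOut hu
      · cases e; exact Path.vStep hy (Path.yOut hz)
      · cases e
    | loop h1 _ ih =>
      subst hs
      rw [mem_preComp_v] at h1
      rcases h1 with ⟨u, hu, e⟩ | ⟨y, hy, ⟨z, hz, e⟩ | ⟨v', hv, e⟩⟩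
      · cases e
      · cases e
      · cases e; exact Path.vStep hy (Path.yStep hv (ih _ rfl))
  · intro H
    have key : ∀ s o, Path g f s o → (∀ v, s = Sum.inr v → Exit (preComp g f) (Sum.inr v) o) ∧
        (∀ y, s = Sum.inl y → ∀ v', Sum.inl y ∈ f (Sum.inr v') →
          Exit (preComp g f) (Sum.inr v') o) := by
      intro s o H
      induction H with
      | yOut hz =>
        refine ⟨by simp, ?_⟩
        rintro y e v' hv'
        cases e
        exact Exit.out ((mem_preComp_v _ _ _ _).2 (Or.inr ⟨_, hv', Or.inl ⟨_, hz, rfl⟩⟩))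
      | yStep hv _ ih =>
        refine ⟨by simp, ?_⟩
        rintro y e v' hv'
        cases e
        exact Exit.loop ((mem_preComp_v _ _ _ _).2 (Or.inr ⟨_, hv', Or.inr ⟨_, hv, rfl⟩⟩))
          (ih.1 _ rfl)
      | vOut hu =>
        refine ⟨?_, by simp⟩
        rintro v e
        cases e
        exact Exit.out ((mem_preComp_v _ _ _ _).2 (Or.inl ⟨_, hu, rfl⟩))
      | vStep hy _ ih =>
        refine ⟨?_, by simp⟩
        rintro v e
        cases e
        exact ih.2 _ rfl _ hy
    exact (key _ _ H).1 _ rfl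

theorem mem_comp (g : Hom B C) (f : Hom A B) (s o) : o ∈ comp g f s ↔ Enter g f s o := by
  unfold comp trace
  rw [mem_ofRel, traceRel_iff]
  rcases s with x | w
  · constructor
    · rintro (h1 | ⟨h1, h2⟩)
      · rw [mem_preComp_x] at h1
        rcases h1 with ⟨u, hu, e⟩ | ⟨y, hy, ⟨z, hz, e⟩ | ⟨v', hv, e⟩⟩
        · cases e; exact Or.inl ⟨u, hu, rfl⟩
        · cases e; exact Or.inr ⟨y, hy, Path.yOut hz⟩
        · cases e
      · rw [mem_preComp_x] at h1
        rcases h1 with ⟨u, hu, e⟩ | ⟨y, hy, ⟨z, hz, e⟩ | ⟨v', hv, e⟩⟩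
        · cases e
        · cases e
        · cases e
          exact Or.inr ⟨y, hy, Path.yStep hv ((exit_iff_path _ _ _ _).1 h2)⟩
    · rintro (⟨u, hu, rfl⟩ | ⟨y, hy, H⟩)
      · exact Exit.out ((mem_preComp_x _ _ _ _).2 (Or.inl ⟨u, hu, rfl⟩))
      · cases H with
        | yOut hz =>
          exact Exit.out ((mem_preComp_x _ _ _ _).2 (Or.inr ⟨_, hy, Or.inl ⟨_, hz, rfl⟩⟩))
        | yStep hv H =>
          exact Exit.loop ((mem_preComp_x _ _ _ _).2 (Or.inr ⟨_, hy, Or.inr ⟨_, hv, rfl⟩⟩))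
            ((exit_iff_path _ _ _ _).2 H)
  · constructor
    · rintro (h1 | ⟨h1, h2⟩)
      · rw [mem_preComp_w] at h1
        rcases h1 with ⟨z, hz, e⟩ | ⟨v', hv, e⟩
        · cases e; exact Or.inl ⟨z, hz, rfl⟩
        · cases e
      · rw [mem_preComp_w] at h1
        rcases h1 with ⟨z, hz, e⟩ | ⟨v', hv, e⟩
        · cases e
        · cases e
          exact Or.inr ⟨_, hv, (exit_iff_path _ _ _ _).1 h2⟩
    · rintro (⟨z, hz, rfl⟩ | ⟨v, hv, H⟩)
      · exact Exit.out ((mem_preComp_w _ _ _ _).2 (Or.inl ⟨z, hz, rfl⟩))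
      · exact Exit.loop ((mem_preComp_w _ _ _ _).2 (Or.inr ⟨_, hv, rfl⟩))
          ((exit_iff_path _ _ _ _).2 H)

theorem hom_ext {f g : Hom A B} (h : ∀ s o, o ∈ f s ↔ o ∈ g s) : f = g :=
  PEquiv.ext fun s => Option.ext (h s)

theorem id_comp (f : Hom A B) : comp (id B) f = f := by
  refine hom_ext fun s o => ?_
  rw [mem_comp]
  have hy : ∀ y o, Path (id B) f (Sum.inl y) o ↔ o = Sum.inl y := by
    intro y o
    constructor
    · intro H
      cases H with
      | yOut h => cases h; rfl
      | yStep h _ => exact absurd (Option.some.inj h) (by simp)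
    · rintro rfl
      exact Path.yOut rfl
  rcases s with x | w
  · simp only [Enter, hy]
    rcases o with o | o <;> simp
  · simp only [Enter, id, mem_refl]
    constructor
    · rintro (⟨z, hz, -⟩ | ⟨v, hv, H⟩)
      · cases hz
      · cases hv
        cases H with
        | vOut hu => exact hu
        | vStep hy' H => rw [(hy _ _).1 H]; exact hy'
    · intro h
      refine Or.inr ⟨w, rfl, ?_⟩
      rcases o with z | u
      · exact Path.vStep h ((hy _ _).2 rfl)
      · exact Path.vOut h

theorem comp_id (f : Hom A B) : comp f (id A) = f := by
  refine hom_ext fun s o => ?_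
  rw [mem_comp]
  have hv : ∀ v o, Path f (id A) (Sum.inr v) o ↔ o = Sum.inr v := by
    intro y o
    constructor
    · intro H
      cases H with
      | vOut h => cases h; rfl
      | vStep h _ => exact absurd (Option.some.inj h) (by simp)
    · rintro rfl
      exact Path.vOut rfl
  rcases s with x | w
  · simp only [Enter, id, mem_refl]
    constructor
    · rintro (⟨z, hz, -⟩ | ⟨v, hv', H⟩)
      · cases hz
      · cases hv'
        cases H with
        | yOut hu => exact hu
        | yStep hy' H => rw [(hv _ _).1 H]; exact hy'
    · intro h
      refine Or.inr ⟨x, rfl, ?_⟩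
      rcases o with z | u
      · exact Path.yOut h
      · exact Path.yStep h ((hv _ _).2 rfl)
  · simp only [Enter, hv]
    rcases o with o | o <;> simp

/-- Runs on the two common edges of `h`, `g` and `f`. -/
inductive Path₃ (h : Hom C D) (g : Hom B C) (f : Hom A B) :
    (B.pos ⊕ B.neg) ⊕ (C.pos ⊕ C.neg) → D.pos ⊕ A.neg → Prop
  | yz {y z o} : Sum.inl z ∈ g (Sum.inl y) → Path₃ h g f (Sum.inr (Sum.inl z)) o →
      Path₃ h g f (Sum.inl (Sum.inl y)) o
  | yv {y v o} : Sum.inr v ∈ g (Sum.inl y) → Path₃ h g f (Sum.inl (Sum.inr v)) o →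
      Path₃ h g f (Sum.inl (Sum.inl y)) o
  | wz {w z o} : Sum.inl z ∈ g (Sum.inr w) → Path₃ h g f (Sum.inr (Sum.inl z)) o →
      Path₃ h g f (Sum.inr (Sum.inr w)) o
  | wv {w v o} : Sum.inr v ∈ g (Sum.inr w) → Path₃ h g f (Sum.inl (Sum.inr v)) o →
      Path₃ h g f (Sum.inr (Sum.inr w)) o
  | vu {v u} : Sum.inr u ∈ f (Sum.inr v) → Path₃ h g f (Sum.inl (Sum.inr v)) (Sum.inr u)
  | vy {v y o} : Sum.inl y ∈ f (Sum.inr v) → Path₃ h g f (Sum.inl (Sum.inl y)) o →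
      Path₃ h g f (Sum.inl (Sum.inr v)) o
  | zd {z d} : Sum.inl d ∈ h (Sum.inl z) → Path₃ h g f (Sum.inr (Sum.inl z)) (Sum.inl d)
  | zw {z w o} : Sum.inr w ∈ h (Sum.inl z) → Path₃ h g f (Sum.inr (Sum.inr w)) o →
      Path₃ h g f (Sum.inr (Sum.inl z)) o

/-- The first step into the triple composite, followed by a path. -/
def Enter₃ (h : Hom C D) (g : Hom B C) (f : Hom A B) : A.pos ⊕ D.neg → D.pos ⊕ A.neg → Prop
  | Sum.inl x, o => (∃ u, Sum.inr u ∈ f (Sum.inl x) ∧ o = Sum.inr u) ∨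
      ∃ y, Sum.inl y ∈ f (Sum.inl x) ∧ Path₃ h g f (Sum.inl (Sum.inl y)) o
  | Sum.inr k, o => (∃ d, Sum.inl d ∈ h (Sum.inr k) ∧ o = Sum.inl d) ∨
      ∃ w, Sum.inr w ∈ h (Sum.inr k) ∧ Path₃ h g f (Sum.inr (Sum.inr w)) o

theorem path₃_of_gf {h : Hom C D} {g : Hom B C} {f : Hom A B} {s t} (H : Path g f s t) :
    (∀ u, t = Sum.inr u → Path₃ h g f (Sum.inl s) (Sum.inr u)) ∧
    (∀ z o, t = Sum.inl z → Path₃ h g f (Sum.inr (Sum.inl z)) o →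
      Path₃ h g f (Sum.inl s) o) := by
  induction H with
  | yOut hz => exact ⟨by simp, fun z o e k => by cases e; exact Path₃.yz hz k⟩
  | yStep hv _ ih =>
    exact ⟨fun u e => Path₃.yv hv (ih.1 u e), fun z o e k => Path₃.yv hv (ih.2 z o e k)⟩
  | vOut hu => exact ⟨fun u e => by cases e; exact Path₃.vu hu, by simp⟩
  | vStep hy _ ih =>
    exact ⟨fun u e => Path₃.vy hy (ih.1 u e), fun z o e k => Path₃.vy hy (ih.2 z o e k)⟩

theorem path₃_of_h_gf {h : Hom C D} {g : Hom B C} {f : Hom A B} {s o}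
    (H : Path h (comp g f) s o) : Path₃ h g f (Sum.inr s) o := by
  induction H with
  | yOut hz => exact Path₃.zd hz
  | yStep hv _ ih => exact Path₃.zw hv ih
  | vOut hu =>
    rw [mem_comp] at hu
    rcases hu with ⟨z, _, e⟩ | ⟨v, hv, H⟩
    · cases e
    · exact Path₃.wv hv ((path₃_of_gf H).1 _ rfl)
  | vStep hy _ ih =>
    rw [mem_comp] at hy
    rcases hy with ⟨z, hz, e⟩ | ⟨v, hv, H⟩
    · cases e; exact Path₃.wz hz ih
    · exact Path₃.wv hv ((path₃_of_gf H).2 _ _ rfl ih)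

theorem h_gf_of_path₃ {h : Hom C D} {g : Hom B C} {f : Hom A B} {s o}
    (H : Path₃ h g f s o) :
    (∀ t, s = Sum.inr t → Path h (comp g f) t o) ∧
    (∀ t, s = Sum.inl t → (∃ u, o = Sum.inr u ∧ Path g f t (Sum.inr u)) ∨
      ∃ z, Path g f t (Sum.inl z) ∧ Path h (comp g f) (Sum.inl z) o) := by
  induction H with
  | yz hz _ ih =>
    refine ⟨by simp, fun t e => ?_⟩
    cases e
    exact Or.inr ⟨_, Path.yOut hz, ih.1 _ rfl⟩
  | yv hv _ ih =>
    refine ⟨by simp, fun t e => ?_⟩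
    cases e
    rcases ih.2 _ rfl with ⟨u, e, k⟩ | ⟨z, k, k'⟩
    · exact Or.inl ⟨u, e, Path.yStep hv k⟩
    · exact Or.inr ⟨z, Path.yStep hv k, k'⟩
  | wz hz _ ih =>
    refine ⟨fun t e => ?_, by simp⟩
    cases e
    exact Path.vStep ((mem_comp _ _ _ _).2 (Or.inl ⟨_, hz, rfl⟩)) (ih.1 _ rfl)
  | wv hv _ ih =>
    refine ⟨fun t e => ?_, by simp⟩
    cases e
    rcases ih.2 _ rfl with ⟨u, e, k⟩ | ⟨z, k, k'⟩
    · subst e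
      exact Path.vOut ((mem_comp _ _ _ _).2 (Or.inr ⟨_, hv, k⟩))
    · exact Path.vStep ((mem_comp _ _ _ _).2 (Or.inr ⟨_, hv, k⟩)) k'
  | vu hu =>
    refine ⟨by simp, fun t e => ?_⟩
    cases e
    exact Or.inl ⟨_, rfl, Path.vOut hu⟩
  | vy hy _ ih =>
    refine ⟨by simp, fun t e => ?_⟩
    cases e
    rcases ih.2 _ rfl with ⟨u, e, k⟩ | ⟨z, k, k'⟩
    · exact Or.inl ⟨u, e, Path.vStep hy k⟩
    · exact Or.inr ⟨z, Path.vStep hy k, k'⟩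
  | zd hd =>
    refine ⟨fun t e => ?_, by simp⟩
    cases e
    exact Path.yOut hd
  | zw hw _ ih =>
    refine ⟨fun t e => ?_, by simp⟩
    cases e
    exact Path.yStep hw (ih.1 _ rfl)

theorem mem_h_gf (h : Hom C D) (g : Hom B C) (f : Hom A B) (s o) :
    o ∈ comp h (comp g f) s ↔ Enter₃ h g f s o := by
  rw [mem_comp]
  rcases s with x | k
  · constructor
    · rintro (⟨u, hu, rfl⟩ | ⟨z, hz, H⟩)
      · rw [mem_comp] at hu
        rcases hu with ⟨u', hu', e⟩ | ⟨y, hy, H⟩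
        · cases e; exact Or.inl ⟨_, hu', rfl⟩
        · exact Or.inr ⟨y, hy, (path₃_of_gf H).1 _ rfl⟩
      · rw [mem_comp] at hz
        rcases hz with ⟨u', hu', e⟩ | ⟨y, hy, H'⟩
        · cases e
        · exact Or.inr ⟨y, hy, (path₃_of_gf H').2 _ _ rfl (path₃_of_h_gf H)⟩
    · rintro (⟨u, hu, rfl⟩ | ⟨y, hy, H⟩)
      · exact Or.inl ⟨u, (mem_comp _ _ _ _).2 (Or.inl ⟨u, hu, rfl⟩), rfl⟩
      · rcases (h_gf_of_path₃ H).2 _ rfl with ⟨u, e, k⟩ | ⟨z, k, k'⟩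
        · exact Or.inl ⟨u, (mem_comp _ _ _ _).2 (Or.inr ⟨y, hy, k⟩), e⟩
        · exact Or.inr ⟨z, (mem_comp _ _ _ _).2 (Or.inr ⟨y, hy, k⟩), k'⟩
  · constructor
    · rintro (⟨u, hu, rfl⟩ | ⟨z, hz, H⟩)
      · exact Or.inl ⟨u, hu, rfl⟩
      · exact Or.inr ⟨z, hz, path₃_of_h_gf H⟩
    · rintro (⟨u, hu, rfl⟩ | ⟨z, hz, H⟩)
      · exact Or.inl ⟨u, hu, rfl⟩
      · exact Or.inr ⟨z, hz, (h_gf_of_path₃ H).1 _ rfl⟩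

theorem path₃_of_hg {h : Hom C D} {g : Hom B C} {f : Hom A B} {s t} (H : Path h g s t) :
    (∀ d, t = Sum.inl d → Path₃ h g f (Sum.inr s) (Sum.inl d)) ∧
    (∀ v o, t = Sum.inr v → Path₃ h g f (Sum.inl (Sum.inr v)) o →
      Path₃ h g f (Sum.inr s) o) := by
  induction H with
  | yOut hz => exact ⟨fun u e => by cases e; exact Path₃.zd hz, by simp⟩
  | yStep hv _ ih =>
    exact ⟨fun u e => Path₃.zw hv (ih.1 u e), fun z o e k => Path₃.zw hv (ih.2 z o e k)⟩
  | vOut hu => exact ⟨by simp, fun z o e k => by cases e; exact Path₃.wv hu k⟩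
  | vStep hy _ ih =>
    exact ⟨fun u e => Path₃.wz hy (ih.1 u e), fun z o e k => Path₃.wz hy (ih.2 z o e k)⟩

theorem path₃_of_hg_f {h : Hom C D} {g : Hom B C} {f : Hom A B} {s o}
    (H : Path (comp h g) f s o) : Path₃ h g f (Sum.inl s) o := by
  induction H with
  | vOut hz => exact Path₃.vu hz
  | vStep hv _ ih => exact Path₃.vy hv ih
  | yOut hu =>
    rw [mem_comp] at hu
    rcases hu with ⟨z, _, e⟩ | ⟨v, hv, H⟩
    · cases e
    · exact Path₃.yz hv ((path₃_of_hg H).1 _ rfl)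
  | yStep hy _ ih =>
    rw [mem_comp] at hy
    rcases hy with ⟨z, hz, e⟩ | ⟨v, hv, H⟩
    · cases e; exact Path₃.yv hz ih
    · exact Path₃.yz hv ((path₃_of_hg H).2 _ _ rfl ih)

theorem hg_f_of_path₃ {h : Hom C D} {g : Hom B C} {f : Hom A B} {s o}
    (H : Path₃ h g f s o) :
    (∀ t, s = Sum.inl t → Path (comp h g) f t o) ∧
    (∀ t, s = Sum.inr t → (∃ d, o = Sum.inl d ∧ Path h g t (Sum.inl d)) ∨
      ∃ v, Path h g t (Sum.inr v) ∧ Path (comp h g) f (Sum.inr v) o) := by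
  induction H with
  | wv hz _ ih =>
    refine ⟨by simp, fun t e => ?_⟩
    cases e
    exact Or.inr ⟨_, Path.vOut hz, ih.1 _ rfl⟩
  | wz hv _ ih =>
    refine ⟨by simp, fun t e => ?_⟩
    cases e
    rcases ih.2 _ rfl with ⟨u, e, k⟩ | ⟨z, k, k'⟩
    · exact Or.inl ⟨u, e, Path.vStep hv k⟩
    · exact Or.inr ⟨z, Path.vStep hv k, k'⟩
  | yv hz _ ih =>
    refine ⟨fun t e => ?_, by simp⟩
    cases e
    exact Path.yStep ((mem_comp _ _ _ _).2 (Or.inl ⟨_, hz, rfl⟩)) (ih.1 _ rfl)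
  | yz hv _ ih =>
    refine ⟨fun t e => ?_, by simp⟩
    cases e
    rcases ih.2 _ rfl with ⟨u, e, k⟩ | ⟨z, k, k'⟩
    · subst e
      exact Path.yOut ((mem_comp _ _ _ _).2 (Or.inr ⟨_, hv, k⟩))
    · exact Path.yStep ((mem_comp _ _ _ _).2 (Or.inr ⟨_, hv, k⟩)) k'
  | zd hu =>
    refine ⟨by simp, fun t e => ?_⟩
    cases e
    exact Or.inl ⟨_, rfl, Path.yOut hu⟩
  | zw hy _ ih =>
    refine ⟨by simp, fun t e => ?_⟩
    cases e
    rcases ih.2 _ rfl with ⟨u, e, k⟩ | ⟨z, k, k'⟩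
    · exact Or.inl ⟨u, e, Path.yStep hy k⟩
    · exact Or.inr ⟨z, Path.yStep hy k, k'⟩
  | vu hd =>
    refine ⟨fun t e => ?_, by simp⟩
    cases e
    exact Path.vOut hd
  | vy hw _ ih =>
    refine ⟨fun t e => ?_, by simp⟩
    cases e
    exact Path.vStep hw (ih.1 _ rfl)

theorem mem_hg_f (h : Hom C D) (g : Hom B C) (f : Hom A B) (s o) :
    o ∈ comp (comp h g) f s ↔ Enter₃ h g f s o := by
  rw [mem_comp]
  rcases s with x | k
  · constructor
    · rintro (⟨u, hu, rfl⟩ | ⟨z, hz, H⟩)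
      · exact Or.inl ⟨u, hu, rfl⟩
      · exact Or.inr ⟨z, hz, path₃_of_hg_f H⟩
    · rintro (⟨u, hu, rfl⟩ | ⟨z, hz, H⟩)
      · exact Or.inl ⟨u, hu, rfl⟩
      · exact Or.inr ⟨z, hz, (hg_f_of_path₃ H).1 _ rfl⟩
  · constructor
    · rintro (⟨u, hu, rfl⟩ | ⟨z, hz, H⟩)
      · rw [mem_comp] at hu
        rcases hu with ⟨u', hu', e⟩ | ⟨y, hy, H⟩
        · cases e; exact Or.inl ⟨_, hu', rfl⟩
        · exact Or.inr ⟨y, hy, (path₃_of_hg H).1 _ rfl⟩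
      · rw [mem_comp] at hz
        rcases hz with ⟨u', hu', e⟩ | ⟨y, hy, H'⟩
        · cases e
        · exact Or.inr ⟨y, hy, (path₃_of_hg H').2 _ _ rfl (path₃_of_hg_f H)⟩
    · rintro (⟨u, hu, rfl⟩ | ⟨y, hy, H⟩)
      · exact Or.inl ⟨u, (mem_comp _ _ _ _).2 (Or.inl ⟨u, hu, rfl⟩), rfl⟩
      · rcases (hg_f_of_path₃ H).2 _ rfl with ⟨u, e, k⟩ | ⟨z, k, k'⟩
        · exact Or.inl ⟨u, (mem_comp _ _ _ _).2 (Or.inr ⟨y, hy, k⟩), e⟩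
        · exact Or.inr ⟨z, (mem_comp _ _ _ _).2 (Or.inr ⟨y, hy, k⟩), k'⟩

theorem comp_assoc (h : Hom C D) (g : Hom B C) (f : Hom A B) :
    comp (comp h g) f = comp h (comp g f) :=
  hom_ext fun s o => by rw [mem_hg_f, mem_h_gf]

end Assoc

end IntObj

/-! ### The two semi-monoidal structures on the partial injections of `ℕ` -/

/-- The common underlying set `𝓗` of the endomorphism monoids. Its multiplication `g * f` is
`g · f`, the composition of partial injections. -/
abbrev H : Type := ℕ ≃. ℕ

/-- The Cantor pairing `ℕ ⊎ ℕ → ℕ`, `inl n ↦ 2n`, `inr n ↦ 2n + 1`. -/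
def code : ℕ ⊕ ℕ ≃ ℕ := Equiv.natSumNatEquivNat

/-- The object `(ℕ, ℕ)` of `Int(pInj)`. -/
abbrev N : IntObj := ⟨ℕ, ℕ⟩

/-- The rook square of a partial injection of `ℕ` (conjugation by the Cantor pairing). -/
def sq (f : H) : IntObj.Hom N N := (code.toPEquiv.trans f).trans code.symm.toPEquiv

/-- The partial injection of `ℕ` with a given rook square. -/
def unsq (F : IntObj.Hom N N) : H := (code.symm.toPEquiv.trans F).trans code.toPEquiv

theorem sq_unsq (F : IntObj.Hom N N) : sq (unsq F) = F := by
  have h : code.toPEquiv.trans code.symm.toPEquiv = PEquiv.refl _ := by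
    rw [← Equiv.toPEquiv_trans, Equiv.self_trans_symm, Equiv.toPEquiv_refl]
  calc sq (unsq F) = ((code.toPEquiv.trans code.symm.toPEquiv).trans F).trans
        (code.toPEquiv.trans code.symm.toPEquiv) := by
          simp only [sq, unsq, PEquiv.trans_assoc]
    _ = F := by rw [h, PEquiv.refl_trans, PEquiv.trans_refl]

theorem unsq_sq (f : H) : unsq (sq f) = f := by
  have h : code.symm.toPEquiv.trans code.toPEquiv = PEquiv.refl _ := by
    rw [← Equiv.toPEquiv_trans, Equiv.symm_trans_self, Equiv.toPEquiv_refl]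
  calc unsq (sq f) = ((code.symm.toPEquiv.trans code.toPEquiv).trans f).trans
        (code.symm.toPEquiv.trans code.toPEquiv) := by
          simp only [sq, unsq, PEquiv.trans_assoc]
    _ = f := by rw [h, PEquiv.refl_trans, PEquiv.trans_refl]

theorem sq_one : sq 1 = IntObj.id N := by
  change (code.toPEquiv.trans (PEquiv.refl ℕ)).trans code.symm.toPEquiv = PEquiv.refl _
  rw [PEquiv.trans_refl, ← Equiv.toPEquiv_trans, Equiv.self_trans_symm, Equiv.toPEquiv_refl]

/-- The composition `g · f` of `pInj(ℕ, ℕ)`. -/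
def dot (g f : H) : H := g * f

/-- The composition `g ∘ f` of the endomorphism monoid of `(ℕ, ℕ)` in `𝔊`. -/
noncomputable def circ (g f : H) : H := unsq (IntObj.comp (sq g) (sq f))

/-- The tensor `f ⋆ g = ◁ (f ⊎ g) ▷` for `(𝓗, ·)`. -/
def pstar (f g : H) : H := (code.symm.toPEquiv.trans (sum f g)).trans code.toPEquiv

/-- The tensor `f □ g` for `(𝓗, ∘)`: the tensor of `Int(pInj)`, with `ℕ ⊎ ℕ` identified with `ℕ`
along the Cantor pairing. -/
def box (f g : H) : H :=
  unsq (((code.symm.sumCongr code.symm).toPEquiv.trans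
    (IntObj.tensorHom (sq f) (sq g))).trans (code.sumCongr code).toPEquiv)

infixl:70 " ⊙ " => dot
infixl:70 " ⊚ " => circ
infixl:75 " ⊛ " => pstar
infixl:75 " ⊡ " => box

/-- The symmetry of `⋆`, which exchanges `2n` and `2n + 1`. -/
def σ : H := ((code.symm.trans (Equiv.sumComm ℕ ℕ)).trans code).toPEquiv

/-- The associativity isomorphism of `⋆`,
`ℕ ≃ ℕ ⊎ ℕ ≃ ℕ ⊎ (ℕ ⊎ ℕ) ≃ (ℕ ⊎ ℕ) ⊎ ℕ ≃ ℕ ⊎ ℕ ≃ ℕ`. -/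
def τ : H :=
  ((((code.symm.trans ((Equiv.refl ℕ).sumCongr code.symm)).trans
    (Equiv.sumAssoc ℕ ℕ ℕ).symm).trans (code.sumCongr (Equiv.refl ℕ))).trans code).toPEquiv

/-- The generalised inverse of `τ`. -/
def τ' : H := τ.symm

/-- The associativity isomorphism of `□`; as `□` reverses the order of the negative parts, it is
`τ` on both parts of the rook square. -/
def T : H := τ ⊛ τ

/-- The inverse of `T`. -/
def T' : H := τ' ⊛ τ'

/-- The split element `Δ = τ · (1 ⋆ σ)`. -/
def Δ : H := τ ⊙ (1 ⊛ σ)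

/-- The merge element `∇ = (1 ⋆ σ) · τ'`. -/
def nabla : H := (1 ⊛ σ) ⊙ τ'

/-- The set `𝓗` with the composition `∘` (the multiplication of a type of endomorphisms in `𝔊`). -/
def EndG : Type := H

noncomputable instance : Monoid EndG where
  mul := circ
  one := (1 : H)
  mul_assoc f g h := by
    change circ (circ f g) h = circ f (circ g h)
    simp only [circ, sq_unsq, IntObj.comp_assoc]
  one_mul f := by
    change circ 1 f = f
    change unsq (IntObj.comp (sq 1) (sq f)) = f
    rw [sq_one, IntObj.id_comp]
    exact unsq_sq f
  mul_one f := by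
    change circ f 1 = f
    change unsq (IntObj.comp (sq f) (sq 1)) = f
    rw [sq_one, IntObj.comp_id]
    exact unsq_sq f

/-! ### Abstract notions -/

/-- `(M, comp, one, tensor)` is a semi-monoidal monoid with associativity isomorphism `α`
and inverse `α'`. -/
structure IsSemiMonoidalMonoid {M : Type} (comp : M → M → M) (one : M) (tensor : M → M → M)
    (α α' : M) : Prop where
  comp_assoc : ∀ a b c, comp (comp a b) c = comp a (comp b c)
  one_comp : ∀ a, comp one a = a
  comp_one : ∀ a, comp a one = a
  tensor_one : tensor one one = one
  tensor_comp : ∀ a b c d, tensor (comp a b) (comp c d) = comp (tensor a c) (tensor b d)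
  comp_inv : comp α α' = one
  inv_comp : comp α' α = one
  natural : ∀ a b c,
    comp α (tensor a (tensor b c)) = comp (tensor (tensor a b) c) α
  pentagon : comp (tensor α one) (comp α (tensor one α)) = comp α α

/-- Membership in the closure of a set under two binary operations. -/
inductive OpGenerated {M : Type} (op₁ op₂ : M → M → M) (S : Set M) : M → Prop
  | basic {a} : a ∈ S → OpGenerated op₁ op₂ S a
  | first {a b} : OpGenerated op₁ op₂ S a → OpGenerated op₁ op₂ S b →
      OpGenerated op₁ op₂ S (op₁ a b)
  | second {a b} : OpGenerated op₁ op₂ S a → OpGenerated op₁ op₂ S b →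
      OpGenerated op₁ op₂ S (op₂ a b)

/-- The closure of a set under two binary operations. -/
def opClosure {M : Type} (op₁ op₂ : M → M → M) (S : Set M) : Set M :=
  {a | OpGenerated op₁ op₂ S a}

/-- Thompson's group `⟨x₀, x₁, … | xᵢ⁻¹ xⱼ xᵢ = xⱼ₊₁ for i < j⟩`. -/
abbrev ThompsonF : Type :=
  PresentedGroup {r : FreeGroup ℕ | ∃ i j : ℕ, i < j ∧
    r = (FreeGroup.of i)⁻¹ * FreeGroup.of j * FreeGroup.of i * (FreeGroup.of (j + 1))⁻¹}

/-- The bicyclic monoid `⟨s, r | r s = 1⟩`, with `s` and `r` the generators `false` and `true`. -/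
abbrev Bicyclic : Type :=
  PresentedMonoid fun a b : FreeMonoid Bool =>
    a = FreeMonoid.of true * FreeMonoid.of false ∧ b = 1

/-- The submonoid of `(𝓗, ·)` generated by a set. -/
abbrev dotSubmonoid (S : Set H) : Submonoid H := Submonoid.closure S

/-- The submonoid of `(𝓗, ∘)` generated by a set. -/
noncomputable abbrev circSubmonoid (S : Set H) : Submonoid EndG :=
  Submonoid.closure (M := EndG) S

/-! ### The simple Abramsky–Heunen Frobenius algebra at `(ℕ, ℕ)` -/

/-- `(∅, ℕ)`, whose dual is `(ℕ, ∅)`, so that `(ℕ, ℕ)` is a copy of `X* □ X`. -/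
abbrev X : IntObj := ⟨Empty, ℕ⟩

/-- The isomorphism `X* □ X → (ℕ, ℕ)` and its inverse. -/
def ν : IntObj.Hom (IntObj.tensor (IntObj.dual X) X) N :=
  IntObj.ofEquiv (A := IntObj.tensor (IntObj.dual X) X) (B := N)
    (Equiv.sumEmpty ℕ Empty) (Equiv.sumEmpty ℕ Empty).symm

def νInv : IntObj.Hom N (IntObj.tensor (IntObj.dual X) X) :=
  IntObj.ofEquiv (A := N) (B := IntObj.tensor (IntObj.dual X) X)
    (Equiv.sumEmpty ℕ Empty).symm (Equiv.sumEmpty ℕ Empty)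

/-- The code isomorphism `(ℕ, ℕ) □ (ℕ, ℕ) → (ℕ, ℕ)` and its inverse. -/
def κ : IntObj.Hom (IntObj.tensor N N) N :=
  IntObj.ofEquiv (A := IntObj.tensor N N) (B := N) code code.symm

def κInv : IntObj.Hom N (IntObj.tensor N N) :=
  IntObj.ofEquiv (A := N) (B := IntObj.tensor N N) code.symm code

open IntObj in
/-- The associativity isomorphism of `Int(pInj)` at `(ℕ, ℕ)`, as an element of `𝓗`. -/
noncomputable def assocStd : H :=
  unsq (comp κ (comp (tensorHom κ (id N)) (comp (assoc N N N)
    (comp (tensorHom (id N) κInv) κInv))))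

open IntObj in
/-- Its inverse. -/
noncomputable def assocInvStd : H :=
  unsq (comp κ (comp (tensorHom (id N) κ) (comp (assocInv N N N)
    (comp (tensorHom κInv (id N)) κInv))))

open IntObj in
/-- The split arrow of the canonical Frobenius algebra at `X* □ X ≅ (ℕ, ℕ)`. -/
noncomputable def splitStd : H :=
  unsq (comp κ (comp (tensorHom ν ν) (comp (IntObj.stdSplit X) νInv)))

open IntObj in
/-- The merge arrow of the canonical Frobenius algebra at `X* □ X ≅ (ℕ, ℕ)`. -/
noncomputable def mergeStd : H :=
  unsq (comp ν (comp (IntObj.stdMerge X) (comp (tensorHom νInv νInv) κInv)))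

/-- The simple Abramsky–Heunen Frobenius monoid at `(ℕ, ℕ)`. -/
def simpleAHFMonoid : Set H :=
  opClosure circ box {assocStd, assocInvStd, splitStd, mergeStd}

end GoI

open GoI

/-! Thompson's group. In any semi-monoidal monoid, naturality of `α` at `(1, 1, a)` says that
conjugation by `α` turns `1 ⊗ a` into `1 ⊗ (1 ⊗ a)`. The iterated whiskerings `α, 1 ⊗ α, 1 ⊗ (1 ⊗
α), …` therefore satisfy the relations of F, and F maps onto the submonoid generated by `α`, `1 ⊗ α`
and their inverses (`thompsonHom`, `mrange_thompsonHom`). The pentagon writes `α ⊗ 1` as a word in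
these generators, so this submonoid is already closed under the tensor (`closure_eq_opClosure`).
Every element of F is a fraction of positive normal forms `x₀^a₀ x₁^a₁ ⋯`. The map is therefore
faithful as soon as `1 ⊗ -` is injective and no positive power of `α` carries one element `1 ⊗ a` to
another (`thompsonHom_injective`). For `τ` and `T` this is seen on one token: `1 ⊗ a` fixes 2, while
each further factor `τ` or `T` doubles it.

The compact closed structure. A composite in `Int(pInj)` is computed by following a token back and
forth between the two factors until it exits. `afterFst_inl` and `afterSnd_inr` are the single steps
of this walk, and with them each concrete identity becomes a check on binary prefixes `L`, `R` of
tokens. The interchange law holds because the two factors of `□` act on disjoint relabelled copies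
of the tokens (`comp_map`, `box_circ`).

The Frobenius algebra. `Δ` and `nabla` are a cup and a cap between two through wires. In `nabla ∘ Δ`
they close to a loop that no token enters, which gives 1; in `Δ ∘ nabla` they turn tokens back. Any
`r`, `s` with `r s = 1 ≠ s r` generate a bicyclic monoid. -/

namespace GoI

/-! ### Normal forms in Thompson's group -/

namespace ThompsonF

/-- The standard generators of Thompson's group. -/
abbrev gen (n : ℕ) : ThompsonF := PresentedGroup.of n

theorem gen_conj {i j : ℕ} (hij : i < j) : (gen i)⁻¹ * gen j * gen i = gen (j + 1) := by
  have h := PresentedGroup.one_of_mem (rels := {r : FreeGroup ℕ | ∃ i j : ℕ, i < j ∧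
    r = (FreeGroup.of i)⁻¹ * FreeGroup.of j * FreeGroup.of i * (FreeGroup.of (j + 1))⁻¹})
    ⟨i, j, hij, rfl⟩
  simp only [map_mul, map_inv] at h
  exact mul_inv_eq_one.1 h

theorem gen_mul_gen {i j : ℕ} (hij : i < j) : gen j * gen i = gen i * gen (j + 1) := by
  rw [← gen_conj hij]; group

/-- The homomorphism out of Thompson's group given by elements that satisfy its relations. -/
def lift {G : Type*} [Group G] (x : ℕ → G)
    (hx : ∀ i j, i < j → (x i)⁻¹ * x j * x i = x (j + 1)) : ThompsonF →* G :=
  PresentedGroup.toGroup (f := x) (by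
    rintro r ⟨i, j, hij, rfl⟩
    simp [← hx i j hij])

@[simp]
theorem lift_gen {G : Type*} [Group G] (x : ℕ → G)
    (hx : ∀ i j, i < j → (x i)⁻¹ * x j * x i = x (j + 1)) (n : ℕ) : lift x hx (gen n) = x n :=
  PresentedGroup.toGroup.of _

/-- The endomorphism `xₙ ↦ xₙ₊₁`. -/
def shift : ThompsonF →* ThompsonF :=
  lift (fun n => gen (n + 1)) fun _ _ h => gen_conj (Nat.succ_lt_succ h)

@[simp]
theorem shift_gen (n : ℕ) : shift (gen n) = gen (n + 1) := lift_gen _ _ n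

theorem hom_ext {G : Type*} [Group G] {f g : ThompsonF →* G} (h : ∀ n, f (gen n) = g (gen n)) :
    f = g :=
  PresentedGroup.ext h

/-- Both sides are homomorphisms in `w`, and on generators they agree by the relations with `i = 0`.
-/
theorem conj_shift (w : ThompsonF) : (gen 0)⁻¹ * shift w * gen 0 = shift (shift w) := by
  have h : ((MulAut.conj (gen 0)⁻¹).toMonoidHom.comp shift) = shift.comp shift :=
    hom_ext fun n => by
      simpa using gen_conj (Nat.succ_pos n)
  simpa using DFunLike.congr_fun h w

theorem shift_mul_gen_zero (w : ThompsonF) : shift w * gen 0 = gen 0 * shift (shift w) := by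
  rw [← conj_shift]; group

theorem inv_gen_zero_mul_shift (w : ThompsonF) :
    (gen 0)⁻¹ * shift w = shift (shift w) * (gen 0)⁻¹ := by
  rw [← conj_shift]; group

/-- Each `x₀` passed raises the index by one. The new index is again a successor, so the generator
lies in the image of `shift` and can enter the tail of a normal form. -/
theorem gen_succ_mul_pow (n a : ℕ) :
    gen (n + 1) * gen 0 ^ a = gen 0 ^ a * gen (n + a + 1) := by
  induction a with
  | zero => simp
  | succ a ih =>
    rw [pow_succ, ← mul_assoc, ih, mul_assoc, gen_mul_gen (Nat.succ_pos _), ← mul_assoc]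
    rfl

theorem inv_gen_succ_mul_pow (n a : ℕ) :
    (gen (n + 1))⁻¹ * gen 0 ^ a = gen 0 ^ a * (gen (n + a + 1))⁻¹ := by
  rw [inv_mul_eq_iff_eq_mul, ← mul_assoc, gen_succ_mul_pow]; group

/-- The positive normal form `x₀ ^ a₀ * x₁ ^ a₁ * ⋯`. -/
def normalForm : List ℕ → ThompsonF
  | [] => 1
  | a :: l => gen 0 ^ a * shift (normalForm l)

theorem exists_gen_eq (n : ℕ) : ∃ l, gen n = normalForm l := by
  induction n with
  | zero => exact ⟨[1], by simp [normalForm]⟩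
  | succ n ih =>
    obtain ⟨l, hl⟩ := ih
    exact ⟨0 :: l, by rw [normalForm, ← hl]; simp⟩

theorem exists_gen_mul_eq (n : ℕ) (l : List ℕ) :
    ∃ l', gen n * normalForm l = normalForm l' := by
  induction l generalizing n with
  | nil => simpa [normalForm] using exists_gen_eq n
  | cons a l ih =>
    rcases n with _ | n
    · exact ⟨(a + 1) :: l, by simp [normalForm, pow_succ', mul_assoc]⟩
    · obtain ⟨l', hl'⟩ := ih (n + a)
      refine ⟨a :: l', ?_⟩
      rw [normalForm, normalForm, ← hl', map_mul, shift_gen, ← mul_assoc, gen_succ_mul_pow,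
        mul_assoc]

theorem exists_mul_gen_eq (n : ℕ) (l : List ℕ) :
    ∃ l', normalForm l * gen n = normalForm l' := by
  induction l generalizing n with
  | nil => simpa [normalForm] using exists_gen_eq n
  | cons a l ih =>
    rcases n with _ | n
    -- Moving `x₀` left across the tail shifts the tail once more; the inserted exponent 0 records
    -- this second shift.
    · exact ⟨(a + 1) :: 0 :: l, by simp [normalForm, pow_succ, mul_assoc, shift_mul_gen_zero]⟩
    · obtain ⟨l', hl'⟩ := ih n
      exact ⟨a :: l', by rw [normalForm, normalForm, ← hl', map_mul, shift_gen, mul_assoc]⟩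

/-- An inverse generator moves to the right until it cancels against a letter or leaves the word; in
the second case one inverse remains at the right end, ready to join a denominator. -/
theorem exists_inv_gen_mul_eq (n : ℕ) (l : List ℕ) :
    (∃ l', (gen n)⁻¹ * normalForm l = normalForm l') ∨
      ∃ l' m, (gen n)⁻¹ * normalForm l = normalForm l' * (gen m)⁻¹ := by
  induction l generalizing n with
  | nil => exact Or.inr ⟨[], n, by simp [normalForm]⟩
  | cons a l ih =>
    rcases n with _ | n
    · rcases a with _ | a
      · refine Or.inr ⟨0 :: 0 :: l, 0, ?_⟩
        simp only [normalForm, pow_zero, one_mul]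
        exact inv_gen_zero_mul_shift _
      · exact Or.inl ⟨a :: l, by simp [normalForm, pow_succ', mul_assoc]⟩
    · have key : (gen (n + 1))⁻¹ * normalForm (a :: l) =
          gen 0 ^ a * shift ((gen (n + a))⁻¹ * normalForm l) := by
        rw [normalForm, ← mul_assoc, inv_gen_succ_mul_pow, map_mul, map_inv, shift_gen, mul_assoc]
      rcases ih (n + a) with ⟨l', hl'⟩ | ⟨l', m, hl'⟩
      · exact Or.inl ⟨a :: l', by rw [key, hl', normalForm]⟩
      · refine Or.inr ⟨a :: l', m + 1, ?_⟩
        rw [key, hl', normalForm, map_mul, map_inv, shift_gen, mul_assoc]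

/-- Every element of Thompson's group is a fraction of positive normal forms. -/
theorem exists_eq_fraction (w : ThompsonF) :
    ∃ l l', w = normalForm l * (normalForm l')⁻¹ := by
  have hw : w ∈ Subgroup.closure (Set.range gen) := by
    rw [PresentedGroup.closure_range_of]; trivial
  induction hw using Subgroup.closure_induction_left with
  | one => exact ⟨[], [], by simp⟩
  | mul_left x hx y _ ih =>
    obtain ⟨n, rfl⟩ := hx
    obtain ⟨l, l', rfl⟩ := ih
    obtain ⟨k, hk⟩ := exists_gen_mul_eq n l
    exact ⟨k, l', by rw [← mul_assoc, hk]⟩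
  | inv_mul_cancel x hx y _ ih =>
    obtain ⟨n, rfl⟩ := hx
    obtain ⟨l, l', rfl⟩ := ih
    rcases exists_inv_gen_mul_eq n l with ⟨k, hk⟩ | ⟨k, m, hk⟩
    · exact ⟨k, l', by rw [← mul_assoc, hk]⟩
    -- The surviving inverse is absorbed by the denominator, since `x⁻¹ v⁻¹ = (v x)⁻¹`.
    · obtain ⟨k', hk'⟩ := exists_mul_gen_eq m l'
      exact ⟨k, k', by rw [← mul_assoc, hk, ← hk']; group⟩

/-- A homomorphism is injective if it separates positive normal forms. -/
theorem injective_of_normalForm {G : Type*} [Group G] (f : ThompsonF →* G)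
    (hf : ∀ l l', f (normalForm l) = f (normalForm l') → normalForm l = normalForm l') :
    Function.Injective f := by
  rw [injective_iff_map_eq_one]
  intro w hw
  obtain ⟨l, l', rfl⟩ := exists_eq_fraction w
  rw [map_mul, map_inv, mul_inv_eq_one] at hw
  -- Equality is asked of the group elements only: the lists may differ by trailing zeros.
  rw [hf l l' hw, mul_inv_cancel]

end ThompsonF

/-! ### Thompson's group in a semi-monoidal monoid -/

namespace IsSemiMonoidalMonoid

variable {M : Type} [Monoid M] {t : M → M → M} {α α' : M}

/-- Tensoring with the identity on the left. -/
def whisker (h : IsSemiMonoidalMonoid (fun a b : M => a * b) 1 t α α') : M →* M where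
  toFun a := t 1 a
  map_one' := h.tensor_one
  map_mul' a b := by simpa using h.tensor_comp 1 1 a b

/-- Tensoring with the identity on the right. -/
def whiskerRight (h : IsSemiMonoidalMonoid (fun a b : M => a * b) 1 t α α') : M →* M where
  toFun a := t a 1
  map_one' := h.tensor_one
  map_mul' a b := by simpa using h.tensor_comp a b 1 1

/-- The associativity isomorphism as a unit. -/
def assocUnit (h : IsSemiMonoidalMonoid (fun a b : M => a * b) 1 t α α') : Mˣ :=
  ⟨α, α', h.comp_inv, h.inv_comp⟩

/-- The images of the generators of Thompson's group. -/
def thompsonGen (h : IsSemiMonoidalMonoid (fun a b : M => a * b) 1 t α α') : ℕ → Mˣ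
  | 0 => h.assocUnit
  | n + 1 => Units.map h.whisker (thompsonGen h n)

/-! ### Whiskerings of the associativity isomorphism and the relations of Thompson's group -/

variable (h : IsSemiMonoidalMonoid (fun a b : M => a * b) 1 t α α')

include h in
-- Naturality at `(1, 1, a)`, where `1 ⊗ 1 = 1`. This is the source of all the relations of F.
theorem inv_comp_whisker (a : M) : α' * t 1 a * α = t 1 (t 1 a) := by
  have h1 : α * t 1 (t 1 a) = t 1 a * α := by simpa [h.tensor_one] using h.natural 1 1 a
  have h2 : α' * α = 1 := h.inv_comp
  rw [mul_assoc, ← h1, ← mul_assoc, h2, one_mul]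

include h in
theorem whisker_whiskerRight (a : M) : t (t 1 a) 1 = α * t 1 (t a 1) * α' := by
  have h1 : α * t 1 (t a 1) = t (t 1 a) 1 * α := h.natural 1 a 1
  have h2 : α * α' = 1 := h.comp_inv
  rw [h1, mul_assoc, h2, mul_one]

include h in
theorem whisker_comp_inv : t 1 α * t 1 α' = 1 := by
  have h2 : α * α' = 1 := h.comp_inv
  have := map_mul h.whisker α α'
  rw [h2, map_one] at this
  exact this.symm

include h in
theorem whisker_inv_comp : t 1 α' * t 1 α = 1 := by
  have h2 : α' * α = 1 := h.inv_comp
  have := map_mul h.whisker α' α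
  rw [h2, map_one] at this
  exact this.symm

include h in
-- The pentagon, solved for `α ⊗ 1`.
theorem whiskerRight_assoc : t α 1 = α * α * t 1 α' * α' := by
  have h1 : t α 1 * (α * t 1 α) = α * α := h.pentagon
  have h2 : α * α' = 1 := h.comp_inv
  rw [← h1, mul_assoc (t α 1), mul_assoc α, h.whisker_comp_inv, mul_one, mul_assoc, h2, mul_one]

include h in
theorem whiskerRight_assocInv : t α' 1 = α * t 1 α * α' * α' := by
  have e : t α 1 * t α' 1 = 1 := by
    have h2 : α * α' = 1 := h.comp_inv
    have := map_mul h.whiskerRight α α'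
    rw [h2, map_one] at this
    exact this.symm
  have e' : (α * t 1 α * α' * α') * t α 1 = 1 := by
    have h2 : α' * α = 1 := h.inv_comp
    have h3 : α * α' = 1 := h.comp_inv
    have h4 := h.whisker_comp_inv
    rw [h.whiskerRight_assoc]
    calc α * t 1 α * α' * α' * (α * α * t 1 α' * α')
        = α * t 1 α * α' * (α' * α) * α * t 1 α' * α' := by simp only [mul_assoc]
      _ = α * t 1 α * (α' * α) * t 1 α' * α' := by rw [h2, mul_one, mul_assoc _ α' α, h2]
      _ = α * (t 1 α * t 1 α') * α' := by rw [h2, mul_one, mul_assoc α]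
      _ = 1 := by rw [h4, mul_one, h3]
  exact (left_inv_eq_right_inv e' e).symm

/-- For `i = 0` this is naturality; the other cases are whiskerings of it. -/
theorem thompsonGen_conj (i j : ℕ) (hij : i < j) :
    (h.thompsonGen i)⁻¹ * h.thompsonGen j * h.thompsonGen i = h.thompsonGen (j + 1) := by
  induction i generalizing j with
  | zero =>
    obtain ⟨j, rfl⟩ := Nat.exists_eq_add_one_of_ne_zero hij.ne'
    exact Units.ext (h.inv_comp_whisker _)
  | succ i ih =>
    obtain ⟨j, rfl⟩ := Nat.exists_eq_add_one_of_ne_zero (Nat.ne_zero_of_lt hij)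
    have := congrArg (Units.map h.whisker) (ih j (Nat.lt_of_succ_lt_succ hij))
    simpa only [map_mul, map_inv, thompsonGen] using this

/-- The homomorphism from Thompson's group to the units of a semi-monoidal monoid. -/
def thompsonHom : ThompsonF →* Mˣ := ThompsonF.lift h.thompsonGen h.thompsonGen_conj

theorem thompsonHom_shift (w : ThompsonF) :
    h.thompsonHom (ThompsonF.shift w) = Units.map h.whisker (h.thompsonHom w) := by
  have : h.thompsonHom.comp ThompsonF.shift = (Units.map h.whisker).comp h.thompsonHom :=
    ThompsonF.hom_ext fun n => by simp [thompsonHom, thompsonGen]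
  exact DFunLike.congr_fun this w

theorem thompsonHom_normalForm_cons (a : ℕ) (l : List ℕ) :
    (h.thompsonHom (ThompsonF.normalForm (a :: l)) : M) =
      α ^ a * t 1 (h.thompsonHom (ThompsonF.normalForm l)) := by
  rw [ThompsonF.normalForm, map_mul, map_pow, thompsonHom_shift, Units.val_mul,
    Units.val_pow_eq_pow_val]
  congr 2
  simp [thompsonHom, thompsonGen, assocUnit]

include h in
-- If `m` exceeded `n`, cancelling the invertible `α ^ n` would leave a positive power of `α`
-- carrying `1 ⊗ a` to `1 ⊗ b`.
theorem exponent_le (hα : ∀ k a b, α ^ (k + 1) * t 1 a ≠ t 1 b) {m n : ℕ} {a b : M}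
    (e : α ^ m * t 1 a = α ^ n * t 1 b) : m ≤ n := by
  by_contra hlt
  obtain ⟨k, rfl⟩ := Nat.exists_eq_add_of_lt (not_le.1 hlt)
  rw [show n + k + 1 = n + (k + 1) by rfl, pow_add, mul_assoc] at e
  exact hα k a b ((h.assocUnit ^ n).isUnit.mul_left_cancel (by
    simpa only [Units.val_pow_eq_pow_val, assocUnit] using e))

include h in
theorem exponent_eq (hα : ∀ k a b, α ^ (k + 1) * t 1 a ≠ t 1 b)
    (hinj : ∀ a b, t 1 a = t 1 b → a = b) {m n : ℕ} {a b : M}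
    (e : α ^ m * t 1 a = α ^ n * t 1 b) : m = n ∧ a = b := by
  obtain rfl := le_antisymm (h.exponent_le hα e) (h.exponent_le hα e.symm)
  exact ⟨rfl, hinj _ _ ((h.assocUnit ^ m).isUnit.mul_left_cancel (by
    simpa only [Units.val_pow_eq_pow_val, assocUnit] using e))⟩

/-- The image of a normal form is `α ^ a₀ * (1 ⊗ tail)`. It determines the leading exponent and the
image of the tail, so the exponents are read off one after another. -/
theorem thompsonHom_injective (hα : ∀ k a b, α ^ (k + 1) * t 1 a ≠ t 1 b)
    (hinj : ∀ a b, t 1 a = t 1 b → a = b) : Function.Injective h.thompsonHom := by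
  -- The empty word is read as exponent 0 followed by an empty tail, so that lists of different
  -- lengths can be compared.
  have hnil : (h.thompsonHom (ThompsonF.normalForm []) : M) =
      α ^ 0 * t 1 (h.thompsonHom (ThompsonF.normalForm [])) := by
    have : t 1 1 = (1 : M) := h.tensor_one
    simp [ThompsonF.normalForm, this]
  refine ThompsonF.injective_of_normalForm _ fun l l' e => ?_
  replace e := congrArg Units.val e
  induction l generalizing l' with
  | nil =>
    induction l' with
    | nil => rfl
    | cons b l' ih =>
      rw [hnil, thompsonHom_normalForm_cons] at e
      obtain ⟨rfl, e'⟩ := h.exponent_eq hα hinj e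
      rw [ThompsonF.normalForm.eq_2, ← ih e']
      simp [ThompsonF.normalForm]
  | cons a l ih =>
    rcases l' with _ | ⟨b, l'⟩
    · rw [hnil, thompsonHom_normalForm_cons] at e
      obtain ⟨rfl, e'⟩ := h.exponent_eq hα hinj e
      rw [ThompsonF.normalForm.eq_2, ih _ e']
      simp [ThompsonF.normalForm]
    · rw [thompsonHom_normalForm_cons, thompsonHom_normalForm_cons] at e
      obtain ⟨rfl, e'⟩ := h.exponent_eq hα hinj e
      rw [ThompsonF.normalForm, ih _ e', ThompsonF.normalForm]

/-! ### The submonoid generated by `α`, `1 ⊗ α` and their inverses -/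

include h in
theorem exists_inv_mem_closure {a : M} (ha : a ∈ Submonoid.closure {α, α', t 1 α, t 1 α'}) :
    ∃ b ∈ Submonoid.closure {α, α', t 1 α, t 1 α'}, a * b = 1 ∧ b * a = 1 := by
  have h2 : α' * α = 1 := h.inv_comp
  have h3 : α * α' = 1 := h.comp_inv
  induction ha using Submonoid.closure_induction with
  | mem x hx =>
    rcases hx with rfl | rfl | rfl | rfl
    · exact ⟨_, Submonoid.subset_closure (by simp), h3, h2⟩
    · exact ⟨_, Submonoid.subset_closure (by simp), h2, h3⟩
    · exact ⟨_, Submonoid.subset_closure (by simp), h.whisker_comp_inv, h.whisker_inv_comp⟩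
    · exact ⟨_, Submonoid.subset_closure (by simp), h.whisker_inv_comp, h.whisker_comp_inv⟩
  | one => exact ⟨1, one_mem _, by simp, by simp⟩
  | mul x y _ _ ihx ihy =>
    obtain ⟨u, hu, hu1, hu2⟩ := ihx
    obtain ⟨v, hv, hv1, hv2⟩ := ihy
    refine ⟨v * u, mul_mem hv hu, ?_, ?_⟩
    · rw [mul_assoc, ← mul_assoc y, hv1, one_mul, hu1]
    · rw [mul_assoc, ← mul_assoc u, hu2, one_mul, hv2]

include h in
-- Whiskering is multiplicative, so only generators matter; a twice whiskered `α` or `α'` is a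
-- conjugate of the once whiskered one.
theorem whisker_mem_closure {a : M} (ha : a ∈ Submonoid.closure {α, α', t 1 α, t 1 α'}) :
    t 1 a ∈ Submonoid.closure {α, α', t 1 α, t 1 α'} := by
  have hα : α ∈ Submonoid.closure {α, α', t 1 α, t 1 α'} := Submonoid.subset_closure (by simp)
  have hα' : α' ∈ Submonoid.closure {α, α', t 1 α, t 1 α'} := Submonoid.subset_closure (by simp)
  induction ha using Submonoid.closure_induction with
  | mem x hx =>
    rcases hx with rfl | rfl | rfl | rfl
    · exact Submonoid.subset_closure (by simp)
    · exact Submonoid.subset_closure (by simp)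
    · rw [← h.inv_comp_whisker]
      exact mul_mem (mul_mem hα' (Submonoid.subset_closure (by simp))) hα
    · rw [← h.inv_comp_whisker]
      exact mul_mem (mul_mem hα' (Submonoid.subset_closure (by simp))) hα
  | one =>
    rw [show t 1 1 = (1 : M) from h.tensor_one]
    exact one_mem _
  | mul x y _ _ ihx ihy =>
    rw [show t 1 (x * y) = t 1 x * t 1 y from map_mul h.whisker x y]
    exact mul_mem ihx ihy

include h in
-- The pentagon handles `α ⊗ 1`; naturality at `(1, α, 1)` reduces `(1 ⊗ α) ⊗ 1` to a conjugate of
-- `1 ⊗ (α ⊗ 1)`. The inverses are treated alike.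
theorem whiskerRight_mem_closure {a : M} (ha : a ∈ Submonoid.closure {α, α', t 1 α, t 1 α'}) :
    t a 1 ∈ Submonoid.closure {α, α', t 1 α, t 1 α'} := by
  have hα : α ∈ Submonoid.closure {α, α', t 1 α, t 1 α'} := Submonoid.subset_closure (by simp)
  have hα' : α' ∈ Submonoid.closure {α, α', t 1 α, t 1 α'} := Submonoid.subset_closure (by simp)
  have h1 : t α 1 ∈ Submonoid.closure {α, α', t 1 α, t 1 α'} := by
    rw [h.whiskerRight_assoc]
    exact mul_mem (mul_mem (mul_mem hα hα) (h.whisker_mem_closure hα')) hα'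
  have h2 : t α' 1 ∈ Submonoid.closure {α, α', t 1 α, t 1 α'} := by
    rw [h.whiskerRight_assocInv]
    exact mul_mem (mul_mem (mul_mem hα (h.whisker_mem_closure hα)) hα') hα'
  induction ha using Submonoid.closure_induction with
  | mem x hx =>
    rcases hx with rfl | rfl | rfl | rfl
    · exact h1
    · exact h2
    · rw [h.whisker_whiskerRight]
      exact mul_mem (mul_mem hα (h.whisker_mem_closure h1)) hα'
    · rw [h.whisker_whiskerRight]
      exact mul_mem (mul_mem hα (h.whisker_mem_closure h2)) hα'
  | one =>
    rw [show t 1 1 = (1 : M) from h.tensor_one]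
    exact one_mem _
  | mul x y _ _ ihx ihy =>
    rw [show t (x * y) 1 = t x 1 * t y 1 from map_mul h.whiskerRight x y]
    exact mul_mem ihx ihy

include h in
theorem closure_eq_opClosure :
    (Submonoid.closure {α, α', t 1 α, t 1 α'} : Set M) =
      opClosure (fun a b : M => a * b) t {α, α'} := by
  have h3 : α * α' = 1 := h.comp_inv
  have g1 : OpGenerated (fun a b : M => a * b) t {α, α'} α := .basic (by simp)
  have g2 : OpGenerated (fun a b : M => a * b) t {α, α'} α' := .basic (by simp)
  have g3 : OpGenerated (fun a b : M => a * b) t {α, α'} 1 := h3 ▸ .first g1 g2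
  refine Set.Subset.antisymm (fun a ha => ?_) fun a ha => ?_
  · change OpGenerated _ _ _ _
    induction ha using Submonoid.closure_induction with
    | mem x hx =>
      rcases hx with rfl | rfl | rfl | rfl
      exacts [g1, g2, .second g3 g1, .second g3 g2]
    | one => exact g3
    | mul x y _ _ ihx ihy => exact .first ihx ihy
  · induction ha with
    | basic hx =>
      rcases hx with rfl | rfl
      exacts [Submonoid.subset_closure (by simp), Submonoid.subset_closure (by simp)]
    | first _ _ iha ihb => exact mul_mem iha ihb
    | @second a b _ _ iha ihb =>
      -- Interchange splits a tensor into a right and a left whiskering.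
      have e : t a b = t a 1 * t 1 b := by simpa using h.tensor_comp a 1 1 b
      rw [e]
      exact mul_mem (h.whiskerRight_mem_closure iha) (h.whisker_mem_closure ihb)

theorem thompsonGen_mem (n : ℕ) :
    (h.thompsonGen n : M) ∈ Submonoid.closure {α, α', t 1 α, t 1 α'} := by
  induction n with
  | zero => exact Submonoid.subset_closure (by simp [thompsonGen, assocUnit])
  | succ n ih => exact h.whisker_mem_closure ih

theorem thompsonHom_mem (w : ThompsonF) :
    (h.thompsonHom w : M) ∈ Submonoid.closure {α, α', t 1 α, t 1 α'} := by
  have hw : w ∈ Subgroup.closure (Set.range ThompsonF.gen) := by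
    rw [PresentedGroup.closure_range_of]; trivial
  induction hw using Subgroup.closure_induction with
  | mem x hx =>
    obtain ⟨n, rfl⟩ := hx
    simpa [thompsonHom] using h.thompsonGen_mem n
  | one => simp
  | mul x y _ _ ihx ihy => rw [map_mul]; exact mul_mem ihx ihy
  | inv x _ ih =>
    obtain ⟨b, hb, hb1, -⟩ := h.exists_inv_mem_closure ih
    rw [map_inv, Units.inv_eq_of_mul_eq_one_right hb1]
    exact hb

theorem mrange_thompsonHom :
    MonoidHom.mrange ((Units.coeHom M).comp h.thompsonHom) =
      Submonoid.closure {α, α', t 1 α, t 1 α'} := by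
  refine le_antisymm ?_ (Submonoid.closure_le.2 ?_)
  · rintro _ ⟨w, rfl⟩
    exact h.thompsonHom_mem w
  · rintro _ (rfl | rfl | rfl | rfl)
    · exact ⟨ThompsonF.gen 0, by simp [thompsonHom, thompsonGen, assocUnit]⟩
    · exact ⟨(ThompsonF.gen 0)⁻¹, by simp [thompsonHom, thompsonGen, assocUnit]⟩
    · exact ⟨ThompsonF.gen 1, by simp [thompsonHom, thompsonGen, assocUnit, whisker]⟩
    · refine ⟨(ThompsonF.gen 1)⁻¹, ?_⟩
      rw [MonoidHom.comp_apply, map_inv, thompsonHom, ThompsonF.lift_gen]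
      rfl

include h in
theorem nonempty_equiv_thompsonF (hα : ∀ k a b, α ^ (k + 1) * t 1 a ≠ t 1 b)
    (hinj : ∀ a b, t 1 a = t 1 b → a = b) :
    Nonempty (Submonoid.closure {α, α', t 1 α, t 1 α'} ≃* ThompsonF) := by
  rw [← h.mrange_thompsonHom]
  refine ⟨(MulEquiv.ofBijective (MonoidHom.mrangeRestrict _)
    ⟨fun a b e => ?_, MonoidHom.mrangeRestrict_surjective _⟩).symm⟩
  exact h.thompsonHom_injective hα hinj (Units.ext (congrArg Subtype.val e))

end IsSemiMonoidalMonoid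

/-! ### The bicyclic monoid -/

namespace Bicyclic

variable {M : Type*} [Monoid M] {s r : M}

/-- The homomorphism out of the bicyclic monoid given by `r` and `s` with `r * s = 1`. -/
def lift (hrs : r * s = 1) : Bicyclic →* M :=
  PresentedMonoid.lift (fun b : Bool => if b then r else s) (by
    rintro a b ⟨rfl, rfl⟩
    simpa using hrs)

theorem lift_of (hrs : r * s = 1) (b : Bool) :
    lift hrs (PresentedMonoid.of _ b) = if b then r else s :=
  PresentedMonoid.lift_of _ _

theorem rel : (PresentedMonoid.of _ true : Bicyclic) * PresentedMonoid.of _ false = 1 :=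
  PresentedMonoid.mk_eq_mk_of_rel ⟨rfl, rfl⟩

theorem pow_mul_pow_self (hrs : r * s = 1) (n : ℕ) : r ^ n * s ^ n = 1 := by
  induction n with
  | zero => simp
  | succ n ih => rw [pow_succ, pow_succ', mul_assoc, ← mul_assoc r, hrs, one_mul, ih]

theorem exists_eq (w : Bicyclic) : ∃ a b : ℕ,
    w = PresentedMonoid.of _ false ^ a * PresentedMonoid.of _ true ^ b := by
  have hw : w ∈ Submonoid.closure (Set.range (PresentedMonoid.of _)) := by
    rw [PresentedMonoid.closure_range_of]; trivial
  induction hw using Submonoid.closure_induction_left with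
  | one => exact ⟨0, 0, by simp⟩
  | mul_left x hx y _ ih =>
    obtain ⟨a, b, rfl⟩ := ih
    obtain ⟨_ | _, rfl⟩ := hx
    · exact ⟨a + 1, b, by rw [pow_succ', mul_assoc]⟩
    · rcases a with _ | a
      · exact ⟨0, b + 1, by simp [pow_succ']⟩
      · exact ⟨a, b, by rw [pow_succ', ← mul_assoc, ← mul_assoc, rel, one_mul]⟩

/-- If `a < c`, cancelling `s ^ a` and then multiplying by `s ^ b` on the right gives `s` a right
inverse. It must equal the left inverse `r`, against `s r ≠ 1`. -/
theorem fst_le (hrs : r * s = 1) (hsr : s * r ≠ 1) {a b c d : ℕ}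
    (e : s ^ a * r ^ b = s ^ c * r ^ d) : c ≤ a := by
  by_contra hlt
  obtain ⟨k, rfl⟩ := Nat.exists_eq_add_of_lt (not_le.1 hlt)
  apply hsr
  have e1 : r ^ b = s * (s ^ k * r ^ d) := by
    have := congrArg (r ^ a * ·) e
    simp only [← mul_assoc, pow_mul_pow_self hrs, one_mul] at this
    rw [this, add_assoc, pow_add, ← mul_assoc (r ^ a), pow_mul_pow_self hrs, one_mul, pow_succ',
      mul_assoc]
  have e2 : s * (s ^ k * r ^ d * s ^ b) = 1 := by
    rw [← mul_assoc, ← e1, pow_mul_pow_self hrs]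
  rw [left_inv_eq_right_inv hrs e2, e2]

/-- If `b < d`, then a positive power of `r` is 1, so `r` has a left inverse, which must be `s`. -/
theorem snd_le (hrs : r * s = 1) (hsr : s * r ≠ 1) {b d : ℕ} (e : r ^ b = r ^ d) : d ≤ b := by
  by_contra hlt
  obtain ⟨k, rfl⟩ := Nat.exists_eq_add_of_lt (not_le.1 hlt)
  apply hsr
  have e1 : r ^ k * r = 1 := by
    have := congrArg (· * s ^ b) e
    simp only [pow_mul_pow_self hrs] at this
    rw [this, add_assoc, add_comm, pow_add, mul_assoc, pow_mul_pow_self hrs, mul_one, pow_succ]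
  rw [← left_inv_eq_right_inv e1 hrs, e1]

theorem lift_injective (hrs : r * s = 1) (hsr : s * r ≠ 1) :
    Function.Injective (lift hrs) := by
  intro v w e
  obtain ⟨a, b, rfl⟩ := exists_eq v
  obtain ⟨c, d, rfl⟩ := exists_eq w
  simp only [map_mul, map_pow, lift_of, if_true, Bool.false_eq_true, if_false] at e
  obtain rfl := le_antisymm (fst_le hrs hsr e) (fst_le hrs hsr e.symm)
  have e1 := congrArg (r ^ c * ·) e
  simp only [← mul_assoc, pow_mul_pow_self hrs, one_mul] at e1
  obtain rfl := le_antisymm (snd_le hrs hsr e1) (snd_le hrs hsr e1.symm)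
  rfl

theorem mrange_lift (hrs : r * s = 1) :
    MonoidHom.mrange (lift hrs) = Submonoid.closure {s, r} := by
  rw [MonoidHom.mrange_eq_map, ← PresentedMonoid.closure_range_of, MonoidHom.map_mclosure]
  congr 1
  ext x
  simp [lift_of, eq_comm]

theorem nonempty_closure_equiv (hrs : r * s = 1) (hsr : s * r ≠ 1) :
    Nonempty (Submonoid.closure {s, r} ≃* Bicyclic) := by
  rw [← mrange_lift hrs]
  exact ⟨(MulEquiv.ofBijective (MonoidHom.mrangeRestrict _)
    ⟨fun a b e => lift_injective hrs hsr (congrArg Subtype.val e),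
      MonoidHom.mrangeRestrict_surjective _⟩).symm⟩

end Bicyclic

/-! ### Evaluation of composites in `Int(pInj)` -/

namespace IntObj

variable {A B C D A' B' C' D' : IntObj}

theorem path_unique {g : Hom B C} {f : Hom A B} {s o o'} (H : Path g f s o)
    (H' : Path g f s o') : o = o' := by
  induction H with
  | yOut h1 =>
    cases H' with
    | yOut h2 => exact congrArg Sum.inl (Sum.inl.inj (Option.mem_unique h1 h2))
    | yStep h2 _ => exact absurd (Option.mem_unique h1 h2) (by simp)
  | yStep h1 _ ih =>
    cases H' with
    | yOut h2 => exact absurd (Option.mem_unique h1 h2) (by simp)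
    | yStep h2 h3 =>
      obtain rfl := Sum.inr.inj (Option.mem_unique h1 h2)
      exact ih h3
  | vOut h1 =>
    cases H' with
    | vOut h2 => exact congrArg Sum.inr (Sum.inr.inj (Option.mem_unique h1 h2))
    | vStep h2 _ => exact absurd (Option.mem_unique h1 h2) (by simp)
  | vStep h1 _ ih =>
    cases H' with
    | vOut h2 => exact absurd (Option.mem_unique h1 h2) (by simp)
    | vStep h2 h3 =>
      obtain rfl := Sum.inl.inj (Option.mem_unique h1 h2)
      exact ih h3

open Classical in
/-- The result of running a token from the common edge of `g` and `f` out of `g ∘ f`. -/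
noncomputable def run (g : Hom B C) (f : Hom A B) (s : B.pos ⊕ B.neg) : Option (C.pos ⊕ A.neg) :=
  if h : ∃ o, Path g f s o then some h.choose else none

theorem mem_run {g : Hom B C} {f : Hom A B} {s o} : o ∈ run g f s ↔ Path g f s o := by
  unfold run
  split_ifs with h
  · rw [Option.mem_some_iff]
    exact ⟨fun e => e ▸ h.choose_spec, path_unique h.choose_spec⟩
  · exact ⟨fun e => absurd e (by simp), fun e => absurd ⟨o, e⟩ h⟩

/-- What happens to a token that leaves `f` in `g ∘ f`. -/
noncomputable def afterFst (g : Hom B C) (f : Hom A B) : B.pos ⊕ A.neg → Option (C.pos ⊕ A.neg)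
  | Sum.inl y => run g f (Sum.inl y)
  | Sum.inr u => some (Sum.inr u)

/-- What happens to a token that leaves `g` in `g ∘ f`. -/
noncomputable def afterSnd (g : Hom B C) (f : Hom A B) : C.pos ⊕ B.neg → Option (C.pos ⊕ A.neg)
  | Sum.inl z => some (Sum.inl z)
  | Sum.inr v => run g f (Sum.inr v)

theorem afterFst_inr (g : Hom B C) (f : Hom A B) (u) :
    afterFst g f (Sum.inr u) = some (Sum.inr u) := rfl

theorem afterSnd_inl (g : Hom B C) (f : Hom A B) (z) :
    afterSnd g f (Sum.inl z) = some (Sum.inl z) := rfl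

/-- One step of the walk. A walk may go on for ever, so `run` is chosen from the relation `Path` and
not defined by recursion; this equation and `afterSnd_inr` unfold any walk that ends. -/
theorem afterFst_inl (g : Hom B C) (f : Hom A B) (y) :
    afterFst g f (Sum.inl y) = (g (Sum.inl y)).bind (afterSnd g f) := by
  ext o
  rw [Option.bind_eq_some_iff]
  refine mem_run.trans ⟨fun H => ?_, ?_⟩
  · cases H with
    | yOut h => exact ⟨_, h, rfl⟩
    | yStep h H => exact ⟨_, h, mem_run.2 H⟩
  · rintro ⟨z | v, h, h'⟩
    · cases h'
      exact Path.yOut h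
    · exact Path.yStep h (mem_run.1 h')

theorem afterSnd_inr (g : Hom B C) (f : Hom A B) (v) :
    afterSnd g f (Sum.inr v) = (f (Sum.inr v)).bind (afterFst g f) := by
  ext o
  rw [Option.bind_eq_some_iff]
  refine mem_run.trans ⟨fun H => ?_, ?_⟩
  · cases H with
    | vOut h => exact ⟨_, h, rfl⟩
    | vStep h H => exact ⟨_, h, mem_run.2 H⟩
  · rintro ⟨z | v, h, h'⟩
    · exact Path.vStep h (mem_run.1 h')
    · cases h'
      exact Path.vOut h

theorem comp_inl (g : Hom B C) (f : Hom A B) (x) :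
    comp g f (Sum.inl x) = (f (Sum.inl x)).bind (afterFst g f) := by
  ext o
  rw [Option.bind_eq_some_iff]
  refine (mem_comp _ _ _ _).trans ⟨?_, ?_⟩
  · rintro (⟨u, hu, rfl⟩ | ⟨y, hy, H⟩)
    exacts [⟨_, hu, rfl⟩, ⟨_, hy, mem_run.2 H⟩]
  · rintro ⟨y | u, h, h'⟩
    · exact Or.inr ⟨_, h, mem_run.1 h'⟩
    · cases h'
      exact Or.inl ⟨_, h, rfl⟩

theorem comp_inr (g : Hom B C) (f : Hom A B) (w) :
    comp g f (Sum.inr w) = (g (Sum.inr w)).bind (afterSnd g f) := by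
  ext o
  rw [Option.bind_eq_some_iff]
  refine (mem_comp _ _ _ _).trans ⟨?_, ?_⟩
  · rintro (⟨u, hu, rfl⟩ | ⟨y, hy, H⟩)
    exacts [⟨_, hu, rfl⟩, ⟨_, hy, mem_run.2 H⟩]
  · rintro ⟨y | u, h, h'⟩
    · cases h'
      exact Or.inl ⟨_, h, rfl⟩
    · exact Or.inr ⟨_, h, mem_run.1 h'⟩

theorem ofEquiv_apply (φ : A.pos ≃ B.pos) (ψ : B.neg ≃ A.neg) (s) :
    ofEquiv φ ψ s = some (Sum.map φ ψ s) := by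
  rcases s with x | v <;> rfl

/-- A bijection arrow never turns a token back, so the token visits `f` exactly once and composition
is mere relabelling. -/
theorem comp_ofEquiv_left (φ : B.pos ≃ C.pos) (ψ : C.neg ≃ B.neg) (f : Hom A B) (s) :
    comp (ofEquiv φ ψ) f s = (f (Sum.map _root_.id ψ s)).map (Sum.map φ _root_.id) := by
  rcases s with x | w
  · rw [comp_inl, Sum.map_inl]
    rcases hx : f (Sum.inl x) with _ | y | u <;>
      simp [hx, afterFst_inl, afterFst_inr, ofEquiv_apply, afterSnd_inl]
  · rw [comp_inr, Sum.map_inr]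
    simp only [ofEquiv_apply, Sum.map_inr, Option.bind_some, afterSnd_inr]
    rcases f (Sum.inr (ψ w)) with _ | y | u <;>
      simp [afterFst_inl, afterFst_inr, ofEquiv_apply, afterSnd_inl]

theorem comp_ofEquiv_right (f : Hom B C) (φ : A.pos ≃ B.pos) (ψ : B.neg ≃ A.neg) (s) :
    comp f (ofEquiv φ ψ) s = (f (Sum.map φ _root_.id s)).map (Sum.map _root_.id ψ) := by
  rcases s with x | w
  · rw [comp_inl, Sum.map_inl]
    simp only [ofEquiv_apply, Sum.map_inl, Option.bind_some, afterFst_inl]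
    rcases f (Sum.inl (φ x)) with _ | y | u <;>
      simp [afterSnd_inl, afterSnd_inr, ofEquiv_apply, afterFst_inr]
  · rw [comp_inr, Sum.map_inr]
    simp only [_root_.id]
    rcases f (Sum.inr w) with _ | y | u <;>
      simp [afterSnd_inl, afterSnd_inr, ofEquiv_apply, afterFst_inr]

/-- Composition is compatible with relabelling of tokens. -/
theorem comp_map {f : Hom A B} {g : Hom B C} {f' : Hom A' B'} {g' : Hom B' C'}
    (a : A.pos → A'.pos) (a' : A.neg → A'.neg) (b : B.pos → B'.pos) (b' : B.neg → B'.neg)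
    (c : C.pos → C'.pos) (c' : C.neg → C'.neg)
    (hf : ∀ s, f' (Sum.map a b' s) = (f s).map (Sum.map b a'))
    (hg : ∀ s, g' (Sum.map b c' s) = (g s).map (Sum.map c b')) (s) :
    comp g' f' (Sum.map a c' s) = (comp g f s).map (Sum.map c a') := by
  have map_path : ∀ {s o}, Path g f s o → Path g' f' (Sum.map b b' s) (Sum.map c a' o) := by
    intro s o H
    induction H with
    | @yOut y z h =>
      exact Path.yOut ((hg (Sum.inl y)).trans (by rw [Option.mem_def.1 h]; rfl))
    | @yStep y v o h _ ih =>
      exact Path.yStep ((hg (Sum.inl y)).trans (by rw [Option.mem_def.1 h]; rfl)) ih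
    | @vOut v u h =>
      exact Path.vOut ((hf (Sum.inr v)).trans (by rw [Option.mem_def.1 h]; rfl))
    | @vStep v y o h _ ih =>
      exact Path.vStep ((hf (Sum.inr v)).trans (by rw [Option.mem_def.1 h]; rfl)) ih
  -- Conversely, a walk that starts at a relabelled token stays among relabelled tokens, because
  -- `hf` and `hg` compute every step from there.
  have of_path : ∀ {s' o'}, Path g' f' s' o' → ∀ s, s' = Sum.map b b' s →
      ∃ o, o' = Sum.map c a' o ∧ Path g f s o := by
    intro s' o' H
    induction H with
    | @yOut y z h =>
      rintro (s | s) e <;> cases e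
      rw [Option.mem_def, show (Sum.inl (b s) : B'.pos ⊕ C'.neg) = Sum.map b c' (Sum.inl s) from rfl,
        hg, Option.map_eq_some_iff] at h
      obtain ⟨z | v, hz, e⟩ := h <;> cases e
      exact ⟨_, rfl, Path.yOut hz⟩
    | @yStep y v o h _ ih =>
      rintro (s | s) e <;> cases e
      rw [Option.mem_def, show (Sum.inl (b s) : B'.pos ⊕ C'.neg) = Sum.map b c' (Sum.inl s) from rfl,
        hg, Option.map_eq_some_iff] at h
      obtain ⟨z | v, hz, e⟩ := h <;> cases e
      obtain ⟨o, ho, H⟩ := ih (Sum.inr v) rfl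
      exact ⟨o, ho, Path.yStep hz H⟩
    | @vOut v u h =>
      rintro (s | s) e <;> cases e
      rw [Option.mem_def, show (Sum.inr (b' s) : A'.pos ⊕ B'.neg) = Sum.map a b' (Sum.inr s) from rfl,
        hf, Option.map_eq_some_iff] at h
      obtain ⟨z | v, hz, e⟩ := h <;> cases e
      exact ⟨_, rfl, Path.vOut hz⟩
    | @vStep v y o h _ ih =>
      rintro (s | s) e <;> cases e
      rw [Option.mem_def, show (Sum.inr (b' s) : A'.pos ⊕ B'.neg) = Sum.map a b' (Sum.inr s) from rfl,
        hf, Option.map_eq_some_iff] at h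
      obtain ⟨z | v, hz, e⟩ := h <;> cases e
      obtain ⟨o, ho, H⟩ := ih (Sum.inl z) rfl
      exact ⟨o, ho, Path.vStep hz H⟩
  have run_map : ∀ s, run g' f' (Sum.map b b' s) = (run g f s).map (Sum.map c a') := by
    intro s
    ext o'
    rw [Option.map_eq_some_iff]
    refine mem_run.trans ⟨fun H => ?_, ?_⟩
    · obtain ⟨o, rfl, H'⟩ := of_path H s rfl
      exact ⟨o, mem_run.2 H', rfl⟩
    · rintro ⟨o, H, rfl⟩
      exact map_path (mem_run.1 H)
  rcases s with x | w
  · rw [comp_inl, Sum.map_inl, comp_inl,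
      show (Sum.inl (a x) : A'.pos ⊕ B'.neg) = Sum.map a b' (Sum.inl x) from rfl, hf]
    rcases f (Sum.inl x) with _ | y | u
    · rfl
    · exact run_map (Sum.inl y)
    · rfl
  · rw [comp_inr, Sum.map_inr, comp_inr,
      show (Sum.inr (c' w) : B'.pos ⊕ C'.neg) = Sum.map b c' (Sum.inr w) from rfl, hg]
    rcases g (Sum.inr w) with _ | y | u
    · rfl
    · rfl
    · exact run_map (Sum.inr u)

/-! ### Values of the tensor, and arrows given by bijections -/

theorem tensorHom_inl_inl (f : Hom A B) (g : Hom A' B') (x) :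
    tensorHom f g (Sum.inl (Sum.inl x)) = (f (Sum.inl x)).map (Sum.map Sum.inl Sum.inr) := by
  change (((f (Sum.inl x)).map Sum.inl).bind _) = _
  rcases f (Sum.inl x) with _ | y | u <;> rfl

theorem tensorHom_inl_inr (f : Hom A B) (g : Hom A' B') (x) :
    tensorHom f g (Sum.inl (Sum.inr x)) = (g (Sum.inl x)).map (Sum.map Sum.inr Sum.inl) := by
  change (((g (Sum.inl x)).map Sum.inr).bind _) = _
  rcases g (Sum.inl x) with _ | y | u <;> rfl

theorem tensorHom_inr_inl (f : Hom A B) (g : Hom A' B') (x) :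
    tensorHom f g (Sum.inr (Sum.inl x)) = (g (Sum.inr x)).map (Sum.map Sum.inr Sum.inl) := by
  change (((g (Sum.inr x)).map Sum.inr).bind _) = _
  rcases g (Sum.inr x) with _ | y | u <;> rfl

theorem tensorHom_inr_inr (f : Hom A B) (g : Hom A' B') (x) :
    tensorHom f g (Sum.inr (Sum.inr x)) = (f (Sum.inr x)).map (Sum.map Sum.inl Sum.inr) := by
  change (((f (Sum.inr x)).map Sum.inl).bind _) = _
  rcases f (Sum.inr x) with _ | y | u <;> rfl

theorem id_eq_ofEquiv (A : IntObj) :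
    id A = ofEquiv (A := A) (B := A) (Equiv.refl _) (Equiv.refl _) :=
  PEquiv.ext fun s => by rw [ofEquiv_apply]; rcases s with x | v <;> rfl

theorem tensorHom_ofEquiv (φ : A.pos ≃ B.pos) (ψ : B.neg ≃ A.neg) (φ' : A'.pos ≃ B'.pos)
    (ψ' : B'.neg ≃ A'.neg) :
    tensorHom (ofEquiv φ ψ) (ofEquiv φ' ψ') =
      ofEquiv (A := tensor A A') (B := tensor B B') (φ.sumCongr φ') (ψ'.sumCongr ψ) := by
  refine PEquiv.ext fun s => ?_
  rcases s with (x | x) | (x | x)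
  · rw [tensorHom_inl_inl, ofEquiv_apply, ofEquiv_apply]; rfl
  · rw [tensorHom_inl_inr, ofEquiv_apply, ofEquiv_apply]; rfl
  · rw [tensorHom_inr_inl, ofEquiv_apply, ofEquiv_apply]; rfl
  · rw [tensorHom_inr_inr, ofEquiv_apply, ofEquiv_apply]; rfl

theorem ofEquiv_comp_ofEquiv (φ : A.pos ≃ B.pos) (ψ : B.neg ≃ A.neg) (φ' : B.pos ≃ C.pos)
    (ψ' : C.neg ≃ B.neg) :
    comp (ofEquiv φ' ψ') (ofEquiv φ ψ) =
      ofEquiv (A := A) (B := C) (φ.trans φ') (ψ'.trans ψ) := by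
  refine PEquiv.ext fun s => ?_
  rw [comp_ofEquiv_left, ofEquiv_apply, ofEquiv_apply]
  rcases s with x | v <;> rfl

end IntObj

/-! ### Tokens of `ℕ` under the Cantor pairing -/

/-- The left and the right copy of `ℕ` in `ℕ`. -/
abbrev L (n : ℕ) : ℕ := code (Sum.inl n)

abbrev R (n : ℕ) : ℕ := code (Sum.inr n)

theorem code_symm_L (n : ℕ) : code.symm (L n) = Sum.inl n := code.symm_apply_apply _

theorem code_symm_R (n : ℕ) : code.symm (R n) = Sum.inr n := code.symm_apply_apply _

theorem L_eq (n : ℕ) : L n = 2 * n := by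
  simp [L, code]

theorem eq_L_or_eq_R (n : ℕ) : (∃ m, n = L m) ∨ ∃ m, n = R m := by
  rcases h : code.symm n with m | m
  · exact Or.inl ⟨m, by rw [L, ← h, Equiv.apply_symm_apply]⟩
  · exact Or.inr ⟨m, by rw [R, ← h, Equiv.apply_symm_apply]⟩

@[elab_as_elim]
theorem token_cases {P : ℕ → Prop} (hL : ∀ n, P (L n)) (hR : ∀ n, P (R n)) (n : ℕ) : P n := by
  rcases eq_L_or_eq_R n with ⟨m, rfl⟩ | ⟨m, rfl⟩
  exacts [hL m, hR m]

theorem L_injective : Function.Injective L := code.injective.comp Sum.inl_injective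

theorem R_injective : Function.Injective R := code.injective.comp Sum.inr_injective

theorem dot_apply (g f : H) (n : ℕ) : dot g f n = (f n).bind g := rfl

theorem one_apply (n : ℕ) : (1 : H) n = some n := rfl

theorem pstar_L (f g : H) (n : ℕ) : pstar f g (L n) = (f n).map L := by
  change ((((some (code.symm (L n))).bind (sum f g))).bind _) = _
  rw [code_symm_L]
  change (((f n).map Sum.inl).bind _) = _
  rcases f n with _ | m <;> rfl

theorem pstar_R (f g : H) (n : ℕ) : pstar f g (R n) = (g n).map R := by
  change ((((some (code.symm (R n))).bind (sum f g))).bind _) = _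
  rw [code_symm_R]
  change (((g n).map Sum.inr).bind _) = _
  rcases g n with _ | m <;> rfl

/-- The bijection underlying the associativity isomorphism of `⋆`. -/
def assocEquiv : ℕ ≃ ℕ :=
  (((code.symm.trans ((Equiv.refl ℕ).sumCongr code.symm)).trans
    (Equiv.sumAssoc ℕ ℕ ℕ).symm).trans (code.sumCongr (Equiv.refl ℕ))).trans code

-- The bijection rewrites prefixes: `L ↦ LL`, `RL ↦ LR`, `RR ↦ R`. Identities that involve it are
-- checked prefix by prefix.
@[simp]
theorem assocEquiv_L (n : ℕ) : assocEquiv (L n) = L (L n) := by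
  simp [assocEquiv]

@[simp]
theorem assocEquiv_RL (n : ℕ) : assocEquiv (R (L n)) = L (R n) := by
  simp [assocEquiv]

@[simp]
theorem assocEquiv_RR (n : ℕ) : assocEquiv (R (R n)) = R n := by
  simp [assocEquiv]

@[simp]
theorem assocEquiv_symm_LL (n : ℕ) : assocEquiv.symm (L (L n)) = L n := by
  rw [← assocEquiv_L, Equiv.symm_apply_apply]

@[simp]
theorem assocEquiv_symm_LR (n : ℕ) : assocEquiv.symm (L (R n)) = R (L n) := by
  rw [← assocEquiv_RL, Equiv.symm_apply_apply]

@[simp]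
theorem assocEquiv_symm_R (n : ℕ) : assocEquiv.symm (R n) = R (R n) :=
  (Equiv.symm_apply_eq _).2 (assocEquiv_RR n).symm

theorem τ_apply (n : ℕ) : τ n = some (assocEquiv n) := rfl

theorem τ'_apply (n : ℕ) : τ' n = some (assocEquiv.symm n) := rfl

theorem H_ext {f g : H} (hL : ∀ n, f (L n) = g (L n)) (hR : ∀ n, f (R n) = g (R n)) : f = g :=
  PEquiv.ext fun n => token_cases hL hR n

theorem isSemiMonoidalMonoid_dot : IsSemiMonoidalMonoid dot 1 pstar τ τ' where
  comp_assoc a b c := mul_assoc (a : H) b c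
  one_comp a := one_mul (a : H)
  comp_one a := mul_one (a : H)
  tensor_one := H_ext (fun n => by rw [pstar_L]; rfl) (fun n => by rw [pstar_R]; rfl)
  tensor_comp a b c d := by
    refine H_ext (fun n => ?_) fun n => ?_
    · simp only [pstar_L, dot_apply]
      rcases b n with _ | m <;> simp [pstar_L]
    · simp only [pstar_R, dot_apply]
      rcases d n with _ | m <;> simp [pstar_R]
  comp_inv := PEquiv.ext fun n => by simp [dot_apply, τ_apply, τ'_apply, one_apply]
  inv_comp := PEquiv.ext fun n => by simp [dot_apply, τ_apply, τ'_apply, one_apply]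
  natural a b c := by
    refine H_ext (fun n => ?_) (fun n => token_cases (fun n => ?_) (fun n => ?_) n)
    · simp only [dot_apply, τ_apply, pstar_L, assocEquiv_L, Option.bind_some]
      rcases a n with _ | m <;> simp [τ_apply, assocEquiv_L]
    · simp only [dot_apply, τ_apply, pstar_L, pstar_R, assocEquiv_RL, Option.bind_some]
      rcases b n with _ | m <;> simp [τ_apply, assocEquiv_RL]
    · simp only [dot_apply, τ_apply, pstar_R, assocEquiv_RR, Option.bind_some]
      rcases c n with _ | m <;> simp [τ_apply, assocEquiv_RR]
  pentagon := by
    -- The cases `L`, `RL`, `RRL`, `RRR` are the four factors of a tensor bracketed to the right.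
    refine H_ext (fun n => ?_) (fun n => token_cases (fun n => ?_)
      (fun n => token_cases (fun n => ?_) (fun n => ?_) n) n) <;>
    simp only [dot_apply, τ_apply, pstar_L, pstar_R, assocEquiv_L, assocEquiv_RL, assocEquiv_RR,
      Option.bind_some, Option.map_some, one_apply]

/-! ### The tensor of `Int(pInj)` at `(ℕ, ℕ)` -/

/-- The action of a partial injection, read as an endomorphism of `(ℕ, ℕ)`, on tokens. -/
def act (f : H) : ℕ ⊕ ℕ → Option (ℕ ⊕ ℕ) := sq f

theorem act_ext {f g : H} (h₁ : ∀ n, act f (Sum.inl n) = act g (Sum.inl n))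
    (h₂ : ∀ n, act f (Sum.inr n) = act g (Sum.inr n)) : f = g := by
  have e : sq f = sq g := PEquiv.ext fun s => by
    rcases s with n | n
    exacts [h₁ n, h₂ n]
  rw [← unsq_sq f, ← unsq_sq g, e]

theorem act_eq (f : H) (s : ℕ ⊕ ℕ) : act f s = (f (code s)).map code.symm := by
  change (f (code s)).bind _ = _
  rcases f (code s) with _ | m <;> rfl

@[simp]
theorem act_one (s : ℕ ⊕ ℕ) : act 1 s = some s := by
  rw [act, sq_one]; rfl

theorem sq_circ (g f : H) : sq (circ g f) = IntObj.comp (sq g) (sq f) := sq_unsq _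

theorem act_box (f g : H) (s : ℕ ⊕ ℕ) : act (box f g) s =
    (IntObj.tensorHom (sq f) (sq g) (Sum.map code.symm code.symm s)).map (Sum.map code code) := by
  rw [act, box, sq_unsq]
  change ((some (Sum.map code.symm code.symm s)).bind (IntObj.tensorHom (sq f) (sq g))).bind
    (fun s => some (Sum.map code code s)) = _
  rw [Option.bind_some]
  rcases IntObj.tensorHom (sq f) (sq g) (Sum.map code.symm code.symm s) with _ | m | m <;> rfl

@[simp]
theorem act_box_inl_L (f g : H) (n : ℕ) :
    act (box f g) (Sum.inl (L n)) = (act f (Sum.inl n)).map (Sum.map L R) := by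
  rw [act_box, Sum.map_inl, code_symm_L, IntObj.tensorHom_inl_inl, Option.map_map, Sum.map_comp_map]
  rfl

@[simp]
theorem act_box_inl_R (f g : H) (n : ℕ) :
    act (box f g) (Sum.inl (R n)) = (act g (Sum.inl n)).map (Sum.map R L) := by
  rw [act_box, Sum.map_inl, code_symm_R, IntObj.tensorHom_inl_inr, Option.map_map, Sum.map_comp_map]
  rfl

@[simp]
theorem act_box_inr_L (f g : H) (n : ℕ) :
    act (box f g) (Sum.inr (L n)) = (act g (Sum.inr n)).map (Sum.map R L) := by
  rw [act_box, Sum.map_inr, code_symm_L, IntObj.tensorHom_inr_inl, Option.map_map, Sum.map_comp_map]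
  rfl

@[simp]
theorem act_box_inr_R (f g : H) (n : ℕ) :
    act (box f g) (Sum.inr (R n)) = (act f (Sum.inr n)).map (Sum.map L R) := by
  rw [act_box, Sum.map_inr, code_symm_R, IntObj.tensorHom_inr_inr, Option.map_map, Sum.map_comp_map]
  rfl

/-- Negative parts run backwards and the tensor reverses their order; the two reversals cancel, so
both parts carry `assocEquiv` and not its inverse. -/
theorem sq_T : sq T = IntObj.ofEquiv (A := N) (B := N) assocEquiv assocEquiv := sq_unsq _

theorem sq_T' : sq T' = IntObj.ofEquiv (A := N) (B := N) assocEquiv.symm assocEquiv.symm :=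
  sq_unsq _

@[simp]
theorem act_T (s : ℕ ⊕ ℕ) : act T s = some (Sum.map assocEquiv assocEquiv s) := by
  rw [act, sq_T]
  exact IntObj.ofEquiv_apply _ _ _

@[simp]
theorem act_T' (s : ℕ ⊕ ℕ) : act T' s = some (Sum.map assocEquiv.symm assocEquiv.symm s) := by
  rw [act, sq_T']
  exact IntObj.ofEquiv_apply _ _ _

theorem act_T_circ (f : H) (s : ℕ ⊕ ℕ) : act (circ T f) s =
    (act f (Sum.map _root_.id assocEquiv s)).map (Sum.map assocEquiv _root_.id) := by
  rw [act, sq_circ, sq_T]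
  exact IntObj.comp_ofEquiv_left (C := N) _ _ (sq f) s

theorem act_circ_T (f : H) (s : ℕ ⊕ ℕ) : act (circ f T) s =
    (act f (Sum.map assocEquiv _root_.id s)).map (Sum.map _root_.id assocEquiv) := by
  rw [act, sq_circ, sq_T]
  exact IntObj.comp_ofEquiv_right (A := N) (sq f) _ _ s

theorem act_circ_map {f g f' g' : H} (a b : ℕ → ℕ)
    (hf : ∀ s, act f' (Sum.map a b s) = (act f s).map (Sum.map a b))
    (hg : ∀ s, act g' (Sum.map a b s) = (act g s).map (Sum.map a b)) (s : ℕ ⊕ ℕ) :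
    act (circ g' f') (Sum.map a b s) = (act (circ g f) s).map (Sum.map a b) := by
  simp only [act, sq_circ]
  exact IntObj.comp_map (A := N) (B := N) (C := N) (A' := N) (B' := N) (C' := N)
    (f := sq f) (g := sq g) (f' := sq f') (g' := sq g') a b a b a b hf hg s

theorem act_box_map_left (f g : H) (s : ℕ ⊕ ℕ) :
    act (box f g) (Sum.map L R s) = (act f s).map (Sum.map L R) := by
  rcases s with n | n
  exacts [act_box_inl_L f g n, act_box_inr_R f g n]

theorem act_box_map_right (f g : H) (s : ℕ ⊕ ℕ) :
    act (box f g) (Sum.map R L s) = (act g s).map (Sum.map R L) := by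
  rcases s with n | n
  exacts [act_box_inl_R f g n, act_box_inr_L f g n]

/-- The first tensor factor lives on the tokens `Sum.map L R s`, the second on `Sum.map R L s`. A
walk that starts in one copy stays there, so the composite is computed in each copy separately. -/
theorem box_circ (a b c d : H) :
    box (circ a b) (circ c d) = circ (box a c) (box b d) := by
  have h₁ := act_circ_map L R (act_box_map_left b d) (act_box_map_left a c)
  have h₂ := act_circ_map R L (act_box_map_right b d) (act_box_map_right a c)
  refine act_ext (token_cases (fun n => ?_) fun n => ?_) (token_cases (fun n => ?_) fun n => ?_)
  · exact (act_box_inl_L _ _ n).trans (h₁ (Sum.inl n)).symm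
  · exact (act_box_inl_R _ _ n).trans (h₂ (Sum.inl n)).symm
  · exact (act_box_inr_L _ _ n).trans (h₂ (Sum.inr n)).symm
  · exact (act_box_inr_R _ _ n).trans (h₁ (Sum.inr n)).symm

/-- What happens to a token that leaves `f` in `g ∘ f`. -/
noncomputable def afterFst (g f : H) : ℕ ⊕ ℕ → Option (ℕ ⊕ ℕ) := IntObj.afterFst (sq g) (sq f)

/-- What happens to a token that leaves `g` in `g ∘ f`. -/
noncomputable def afterSnd (g f : H) : ℕ ⊕ ℕ → Option (ℕ ⊕ ℕ) := IntObj.afterSnd (sq g) (sq f)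

@[simp]
theorem afterFst_inl (g f : H) (n : ℕ) :
    afterFst g f (Sum.inl n) = (act g (Sum.inl n)).bind (afterSnd g f) :=
  IntObj.afterFst_inl (sq g) (sq f) n

@[simp]
theorem afterFst_inr (g f : H) (n : ℕ) : afterFst g f (Sum.inr n) = some (Sum.inr n) := rfl

@[simp]
theorem afterSnd_inl (g f : H) (n : ℕ) : afterSnd g f (Sum.inl n) = some (Sum.inl n) := rfl

@[simp]
theorem afterSnd_inr (g f : H) (n : ℕ) :
    afterSnd g f (Sum.inr n) = (act f (Sum.inr n)).bind (afterFst g f) :=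
  IntObj.afterSnd_inr (sq g) (sq f) n

@[simp]
theorem act_circ_inl (g f : H) (n : ℕ) :
    act (circ g f) (Sum.inl n) = (act f (Sum.inl n)).bind (afterFst g f) := by
  rw [act, sq_circ]
  exact IntObj.comp_inl (sq g) (sq f) n

@[simp]
theorem act_circ_inr (g f : H) (n : ℕ) :
    act (circ g f) (Sum.inr n) = (act g (Sum.inr n)).bind (afterSnd g f) := by
  rw [act, sq_circ]
  exact IntObj.comp_inr (sq g) (sq f) n

theorem isSemiMonoidalMonoid_circ : IsSemiMonoidalMonoid circ 1 box T T' where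
  comp_assoc := mul_assoc (G := EndG)
  one_comp := one_mul (M := EndG)
  comp_one := mul_one (M := EndG)
  tensor_one := by
    refine act_ext (token_cases (fun n => ?_) fun n => ?_)
      (token_cases (fun n => ?_) fun n => ?_) <;>
    simp
  tensor_comp := box_circ
  comp_inv := act_ext (fun n => by simp) fun n => by simp
  inv_comp := act_ext (fun n => by simp) fun n => by simp
  natural a b c := by
    refine act_ext (fun n => ?_) (fun n => ?_) <;> rw [act_T_circ, act_circ_T]
    · refine token_cases (fun n => ?_) (fun n => token_cases (fun n => ?_) (fun n => ?_) n) n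
      · simp only [Sum.map_inl, _root_.id, assocEquiv_L, act_box_inl_L]
        rcases act a (Sum.inl n) with _ | m | m <;> simp
      · simp only [Sum.map_inl, _root_.id, assocEquiv_RL, act_box_inl_L, act_box_inl_R]
        rcases act b (Sum.inl n) with _ | m | m <;> simp
      · simp only [Sum.map_inl, _root_.id, assocEquiv_RR, act_box_inl_R]
        rcases act c (Sum.inl n) with _ | m | m <;> simp
    · refine token_cases (fun n => ?_) (fun n => token_cases (fun n => ?_) (fun n => ?_) n) n
      · simp only [Sum.map_inr, _root_.id, assocEquiv_L, act_box_inr_L]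
        rcases act c (Sum.inr n) with _ | m | m <;> simp
      · simp only [Sum.map_inr, _root_.id, assocEquiv_RL, act_box_inr_L, act_box_inr_R]
        rcases act b (Sum.inr n) with _ | m | m <;> simp
      · simp only [Sum.map_inr, _root_.id, assocEquiv_RR, act_box_inr_R]
        rcases act a (Sum.inr n) with _ | m | m <;> simp
  pentagon := by
    refine act_ext (fun n => ?_) (fun n => ?_)
    · refine token_cases (fun n => ?_) (fun n => token_cases (fun n => ?_)
        (fun n => token_cases (fun n => ?_) (fun n => ?_) n) n) n <;>
      simp
    · refine token_cases (fun n => ?_) (fun n => token_cases (fun n => ?_)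
        (fun n => token_cases (fun n => ?_) (fun n => ?_) n) n) n <;>
      simp

/-! ### Faithfulness on Thompson's group -/

theorem one_pstar_injective {a b : H} (h : pstar 1 a = pstar 1 b) : a = b :=
  PEquiv.ext fun n => Option.map_injective R_injective (by
    rw [← pstar_R 1 a, ← pstar_R 1 b, h])

/-- The token `2 = L 1` lies in the left half, which `1 ⋆ a` fixes and on which `τ` is doubling `L n
↦ L (L n)`. The exponent of `τ` is thus visible in the image of 2, whatever `a` is. -/
theorem τ_pow_mul_one_pstar (a : H) (k : ℕ) : (τ ^ k * pstar 1 a : H) 2 = some (2 ^ (k + 1)) := by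
  induction k with
  | zero =>
    rw [pow_zero, one_mul, show 2 = L 1 from (L_eq 1).symm, pstar_L]
    simp [one_apply]
  | succ k ih =>
    rw [pow_succ', mul_assoc]
    refine (dot_apply _ _ _).trans ?_
    rw [ih, Option.bind_some, τ_apply, pow_succ', ← L_eq, assocEquiv_L, L_eq, L_eq]
    ring_nf

theorem τ_pow_mul_ne (k : ℕ) (a b : H) : τ ^ (k + 1) * pstar 1 a ≠ pstar 1 b := by
  intro e
  have h₁ := τ_pow_mul_one_pstar a (k + 1)
  have h₂ := τ_pow_mul_one_pstar b 0
  rw [e] at h₁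
  rw [pow_zero, one_mul, h₁, Option.some_inj] at h₂
  have := Nat.pow_right_injective le_rfl h₂
  omega

theorem one_box_injective {a b : H} (h : box 1 a = box 1 b) : a = b := by
  have hm : Function.Injective (Option.map (Sum.map R L)) :=
    Option.map_injective (Sum.map_injective.2 ⟨R_injective, L_injective⟩)
  exact act_ext (fun n => hm (by rw [← act_box_inl_R 1 a, ← act_box_inl_R 1 b, h]))
    fun n => hm (by rw [← act_box_inr_L 1 a, ← act_box_inr_L 1 b, h])

/-- The associativity isomorphism of `□` as an element of the endomorphism monoid. -/
def EndG.assoc : EndG := T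

/-- The tensor of the endomorphism monoid. -/
def EndG.tensor (f g : EndG) : EndG := box f g

/-- The same token, on the positive side: `T` acts there as `τ` does and sends nothing back. -/
theorem act_assoc_pow_mul_one_tensor (a : EndG) (k : ℕ) :
    act (EndG.assoc ^ k * EndG.tensor 1 a) (Sum.inl 2) = some (Sum.inl (2 ^ (k + 1))) := by
  induction k with
  | zero =>
    rw [pow_zero, one_mul, show 2 = L 1 from (L_eq 1).symm]
    exact act_box_inl_L 1 a 1
  | succ k ih =>
    rw [pow_succ', mul_assoc]
    refine (act_T_circ _ _).trans ?_
    rw [Sum.map_inl, _root_.id, ih, Option.map_some, Sum.map_inl, pow_succ', ← L_eq, assocEquiv_L,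
      L_eq, L_eq]
    ring_nf

theorem assoc_pow_mul_ne (k : ℕ) (a b : EndG) :
    EndG.assoc ^ (k + 1) * EndG.tensor 1 a ≠ EndG.tensor 1 b := by
  intro e
  have h₁ := act_assoc_pow_mul_one_tensor a (k + 1)
  have h₂ := act_assoc_pow_mul_one_tensor b 0
  rw [e] at h₁
  rw [pow_zero, one_mul, h₁, Option.some_inj, Sum.inl.injEq] at h₂
  have := Nat.pow_right_injective le_rfl h₂
  omega

/-! ### The split and merge elements -/

theorem σ_L (n : ℕ) : σ (L n) = some (R n) := by
  change some _ = _
  simp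

theorem σ_R (n : ℕ) : σ (R n) = some (L n) := by
  change some _ = _
  simp

-- The three rules for `Δ` describe a wiring. Of the negative part of the target, `L` belongs to the
-- second factor and `R` to the first, because the tensor reverses it. The positive wire runs to the
-- first factor, the negative wire comes from the second, and the rule `inr (R n) ↦ inl (R n)` is
-- the cup in between. `nabla` is the same picture reversed.
@[simp]
theorem act_Δ_inl (n : ℕ) : act Δ (Sum.inl n) = some (Sum.inl (L n)) := by
  rw [act_eq, Δ, dot_apply, pstar_L]
  simp [one_apply, τ_apply]

@[simp]
theorem act_Δ_inr_L (n : ℕ) : act Δ (Sum.inr (L n)) = some (Sum.inr n) := by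
  rw [act_eq, Δ, dot_apply, pstar_R, σ_L]
  simp [τ_apply]

@[simp]
theorem act_Δ_inr_R (n : ℕ) : act Δ (Sum.inr (R n)) = some (Sum.inl (R n)) := by
  rw [act_eq, Δ, dot_apply, pstar_R, σ_R]
  simp [τ_apply]

@[simp]
theorem act_nabla_inl_L (n : ℕ) : act nabla (Sum.inl (L n)) = some (Sum.inl n) := by
  rw [act_eq, nabla, dot_apply, τ'_apply, assocEquiv_symm_LL, Option.bind_some, pstar_L]
  simp [one_apply]

@[simp]
theorem act_nabla_inl_R (n : ℕ) : act nabla (Sum.inl (R n)) = some (Sum.inr (R n)) := by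
  rw [act_eq, nabla, dot_apply, τ'_apply, assocEquiv_symm_LR, Option.bind_some, pstar_R, σ_L]
  simp

@[simp]
theorem act_nabla_inr (n : ℕ) : act nabla (Sum.inr n) = some (Sum.inr (L n)) := by
  rw [act_eq, nabla, dot_apply, τ'_apply, assocEquiv_symm_R, Option.bind_some, pstar_R, σ_R]
  simp

theorem one_pstar_σ_mul_self : dot (pstar 1 σ) (pstar 1 σ) = 1 := by
  have hσ : dot σ σ = 1 := H_ext (fun n => by rw [dot_apply, σ_L, Option.bind_some, σ_R]; rfl)
    (fun n => by rw [dot_apply, σ_R, Option.bind_some, σ_L]; rfl)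
  have h := isSemiMonoidalMonoid_dot
  rw [← h.tensor_comp, hσ, h.one_comp, h.tensor_one]

theorem Δ_dot_nabla : dot Δ nabla = 1 := by
  have h := isSemiMonoidalMonoid_dot
  rw [Δ, nabla, h.comp_assoc, ← h.comp_assoc (pstar 1 σ), one_pstar_σ_mul_self, h.one_comp,
    h.comp_inv]

theorem nabla_dot_Δ : dot nabla Δ = 1 := by
  have h := isSemiMonoidalMonoid_dot
  rw [Δ, nabla, h.comp_assoc, ← h.comp_assoc τ', h.inv_comp, h.one_comp, one_pstar_σ_mul_self]

/-- The cup of `Δ` and the cap of `nabla` close to a loop on the tokens `R n`. No token enters it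
from outside, so the trace discards it. -/
theorem nabla_circ_Δ : circ nabla Δ = 1 := by
  refine act_ext (fun n => ?_) (fun n => ?_)
  · simp
  · simp

theorem Δ_circ_nabla_ne_one : circ Δ nabla ≠ 1 := by
  intro e
  -- The cap of `nabla` turns this token back before it reaches `Δ`.
  have h : act (circ Δ nabla) (Sum.inl (R 0)) = some (Sum.inr (R 0)) := by
    simp
  rw [e, act_one] at h
  simp at h

/-- Both sides are one wiring: `inl (L n)` and `inr (L n)` pass through, while `inl (R n)` and `inr
(R n)` are exchanged. The composite on the left reaches it after straightening its bent wires. -/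
theorem frobenius_left :
    circ (circ (box 1 nabla) T') (box Δ 1) = circ Δ nabla := by
  have h := isSemiMonoidalMonoid_circ
  rw [h.comp_assoc]
  refine act_ext (fun n => ?_) (fun n => ?_)
  · refine token_cases (fun n => ?_) (fun n => token_cases (fun n => ?_) (fun n => ?_) n) n <;>
    simp
  · refine token_cases (fun n => token_cases (fun n => ?_) (fun n => ?_) n) (fun n => ?_) n <;>
    simp

theorem frobenius_right :
    circ Δ nabla = circ (circ (box nabla 1) T) (box 1 Δ) := by
  have h := isSemiMonoidalMonoid_circ
  rw [h.comp_assoc]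
  refine act_ext (fun n => ?_) (fun n => ?_)
  · refine token_cases (fun n => ?_) (fun n => token_cases (fun n => ?_) (fun n => ?_) n) n <;>
    simp
  · refine token_cases (fun n => token_cases (fun n => ?_) (fun n => ?_) n) (fun n => ?_) n <;>
    simp

/-- Either bracketing keeps the outermost wires and caps the two inner pairs; `T` only relabels.
Co-associativity is the mirror image. -/
theorem merge_assoc :
    circ nabla (box 1 nabla) = circ (circ nabla (box nabla 1)) T := by
  refine act_ext (fun n => ?_) (fun n => ?_)
  · refine token_cases (fun n => ?_) (fun n => token_cases (fun n => ?_) (fun n => ?_) n) n <;>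
    simp
  · simp

theorem split_coassoc :
    circ (box 1 Δ) Δ = circ T' (circ (box Δ 1) Δ) := by
  refine act_ext (fun n => ?_) (fun n => ?_)
  · simp
  · refine token_cases (fun n => token_cases (fun n => ?_) (fun n => ?_) n) (fun n => ?_) n <;>
    simp

/-! ### Comparison with the canonical Frobenius algebra -/

open IntObj in
theorem assocStd_eq : T = assocStd := by
  have e : sq T = comp κ (comp (tensorHom κ (id N)) (comp (assoc N N N)
      (comp (tensorHom (id N) κInv) κInv))) := by
    -- Every arrow here is given by bijections, so the composite collapses to a single `ofEquiv`,
    -- compared prefix by prefix.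
    rw [sq_T, id_eq_ofEquiv, κ, κInv, assoc, tensorHom_ofEquiv, tensorHom_ofEquiv,
      ofEquiv_comp_ofEquiv, ofEquiv_comp_ofEquiv, ofEquiv_comp_ofEquiv, ofEquiv_comp_ofEquiv]
    refine PEquiv.ext fun s => ?_
    rw [ofEquiv_apply, ofEquiv_apply]
    rcases s with n | n
    · refine token_cases (fun n => ?_) (fun n => token_cases (fun n => ?_) (fun n => ?_) n) n <;>
      simp
    · refine token_cases (fun n => ?_) (fun n => token_cases (fun n => ?_) (fun n => ?_) n) n <;>
      simp
  rw [assocStd, ← e, unsq_sq]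

open IntObj in
theorem assocInvStd_eq : T' = assocInvStd := by
  have e : sq T' = comp κ (comp (tensorHom (id N) κ) (comp (assocInv N N N)
      (comp (tensorHom κInv (id N)) κInv))) := by
    rw [sq_T', id_eq_ofEquiv, κ, κInv, assocInv, tensorHom_ofEquiv, tensorHom_ofEquiv,
      ofEquiv_comp_ofEquiv, ofEquiv_comp_ofEquiv, ofEquiv_comp_ofEquiv, ofEquiv_comp_ofEquiv]
    refine PEquiv.ext fun s => ?_
    rw [ofEquiv_apply, ofEquiv_apply]
    rcases s with n | n
    · refine token_cases (fun n => token_cases (fun n => ?_) (fun n => ?_) n) (fun n => ?_) n <;>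
      simp
    · refine token_cases (fun n => token_cases (fun n => ?_) (fun n => ?_) n) (fun n => ?_) n <;>
      simp
  rw [assocInvStd, ← e, unsq_sq]

open IntObj in
theorem splitStd_eq : Δ = splitStd := by
  have e : sq Δ = comp κ (comp (tensorHom ν ν) (comp (IntObj.stdSplit X) νInv)) := by
    refine PEquiv.ext fun s => ?_
    -- All arrows except `1 □ (η □ 1)` are bijections and become relabellings, so only the action of
    -- `η` remains to be compared with the three rules for `Δ`.
    rw [IntObj.stdSplit, id_eq_ofEquiv, id_eq_ofEquiv, κ, ν, νInv, assoc, assocInv, leftUnitInv,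
      tensorHom_ofEquiv, tensorHom_ofEquiv, tensorHom_ofEquiv, comp_ofEquiv_left, comp_ofEquiv_left,
      comp_ofEquiv_right, comp_ofEquiv_left, comp_ofEquiv_left, comp_ofEquiv_right]
    rcases s with n | n
    · refine (act_Δ_inl n).trans ?_
      rfl
    · refine token_cases (fun n => ?_) (fun n => ?_) n
      · refine (act_Δ_inr_L n).trans ?_
        simp
        rfl
      · refine (act_Δ_inr_R n).trans ?_
        simp
        rfl
  rw [splitStd, ← e, unsq_sq]

open IntObj in
theorem mergeStd_eq : nabla = mergeStd := by
  have e : sq nabla = comp ν (comp (IntObj.stdMerge X) (comp (tensorHom νInv νInv) κInv)) := by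
    refine PEquiv.ext fun s => ?_
    rw [IntObj.stdMerge, id_eq_ofEquiv, id_eq_ofEquiv, κInv, ν, νInv, assoc, assocInv, leftUnit,
      tensorHom_ofEquiv, tensorHom_ofEquiv, tensorHom_ofEquiv, ofEquiv_comp_ofEquiv,
      ofEquiv_comp_ofEquiv, comp_ofEquiv_left, comp_ofEquiv_right, comp_ofEquiv_left,
      comp_ofEquiv_right]
    rcases s with n | n
    · refine token_cases (fun n => ?_) (fun n => ?_) n
      · refine (act_nabla_inl_L n).trans ?_
        simp
        rfl
      · refine (act_nabla_inl_R n).trans ?_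
        simp
        rfl
    · refine (act_nabla_inr n).trans ?_
      rfl
  rw [mergeStd, ← e, unsq_sq]

end GoI

open GoI
theorem mainTheorem4 :
    -- the two semi-monoidal monoids on the common underlying set
    (IsSemiMonoidalMonoid dot 1 pstar τ τ' ∧ IsSemiMonoidalMonoid circ 1 box T T') ∧
    -- part 1: Thompson's group in the semi-monoidal monoid of `pInj`
    ((∀ a ∈ dotSubmonoid {τ, τ', 1 ⊛ τ, 1 ⊛ τ'},
        ∃ b ∈ dotSubmonoid {τ, τ', 1 ⊛ τ, 1 ⊛ τ'}, a * b = 1 ∧ b * a = 1) ∧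
      Nonempty (dotSubmonoid {τ, τ', 1 ⊛ τ, 1 ⊛ τ'} ≃* ThompsonF) ∧
      (dotSubmonoid {τ, τ', 1 ⊛ τ, 1 ⊛ τ'} : Set H) = opClosure dot pstar {τ, τ'}) ∧
    -- part 2: Thompson's group in the semi-monoidal monoid of the compact closed category
    ((∀ a ∈ circSubmonoid {T, T', 1 ⊡ T, 1 ⊡ T'},
        ∃ b ∈ circSubmonoid {T, T', 1 ⊡ T, 1 ⊡ T'}, a * b = 1 ∧ b * a = 1) ∧
      Nonempty (circSubmonoid {T, T', 1 ⊡ T, 1 ⊡ T'} ≃* ThompsonF) ∧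
      (circSubmonoid {T, T', 1 ⊡ T, 1 ⊡ T'} : Set EndG) = opClosure circ box {T, T'}) ∧
    -- part 3: the bicyclic monoid
    ((Δ ⊙ nabla = 1 ∧ nabla ⊙ Δ = 1) ∧ (nabla ⊚ Δ = 1 ∧ Δ ⊚ nabla ≠ 1) ∧
      Nonempty (circSubmonoid {Δ, nabla} ≃* Bicyclic)) ∧
    -- part 4: the Frobenius condition, associativity and co-associativity
    (((1 ⊡ nabla) ⊚ T' ⊚ (Δ ⊡ 1) = Δ ⊚ nabla ∧
        Δ ⊚ nabla = (nabla ⊡ 1) ⊚ T ⊚ (1 ⊡ Δ)) ∧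
      nabla ⊚ (1 ⊡ nabla) = nabla ⊚ (nabla ⊡ 1) ⊚ T ∧
      (1 ⊡ Δ) ⊚ Δ = T' ⊚ ((Δ ⊡ 1) ⊚ Δ)) ∧
    -- hence they generate the simple Abramsky--Heunen Frobenius algebra
    ((T = assocStd ∧ T' = assocInvStd) ∧ (Δ = splitStd ∧ nabla = mergeStd) ∧
      opClosure circ box {T, T', Δ, nabla} = simpleAHFMonoid) := by
  -- `dot` and `circ` are by definition the multiplications of `H` and `EndG`, so the abstract
  -- results apply to both structures.
  have hd : IsSemiMonoidalMonoid (fun a b : H => a * b) 1 pstar τ τ' := isSemiMonoidalMonoid_dot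
  have hc : IsSemiMonoidalMonoid (fun a b : EndG => a * b) 1 EndG.tensor EndG.assoc T' :=
    isSemiMonoidalMonoid_circ
  refine ⟨⟨isSemiMonoidalMonoid_dot, isSemiMonoidalMonoid_circ⟩,
    ⟨fun a ha => hd.exists_inv_mem_closure ha,
      hd.nonempty_equiv_thompsonF τ_pow_mul_ne fun _ _ => one_pstar_injective,
      hd.closure_eq_opClosure⟩,
    ⟨fun a ha => hc.exists_inv_mem_closure ha,
      hc.nonempty_equiv_thompsonF assoc_pow_mul_ne fun _ _ => one_box_injective,
      hc.closure_eq_opClosure⟩,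
    ⟨⟨Δ_dot_nabla, nabla_dot_Δ⟩, ⟨nabla_circ_Δ, Δ_circ_nabla_ne_one⟩,
      Bicyclic.nonempty_closure_equiv (M := EndG) nabla_circ_Δ Δ_circ_nabla_ne_one⟩,
    ⟨⟨frobenius_left, frobenius_right⟩, merge_assoc, split_coassoc⟩,
    ⟨assocStd_eq, assocInvStd_eq⟩, ⟨splitStd_eq, mergeStd_eq⟩, ?_⟩
  rw [simpleAHFMonoid, ← assocStd_eq, ← assocInvStd_eq, ← splitStd_eq, ← mergeStd_eq]
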